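/- Let $d\in\mathbb N\cup\{\infty\}$, let $\mathbb F^d$ be the free monoid of words in $d$ letters, and for a Hilbert space $\mathcal E$ let $\mathbb H^2_d\otimes\mathcal E$ be the full Fock space of formal power series $f=\sum_{\omega\in\mathbb F^d}\mathfrak z^\omega f_\omega$ in non-commuting variables $\mathfrak z_1,\dots,\mathfrak z_d$, with $f_\omega\in\mathcal E$ and $\|f\|^2=\sum_\omega\|f_\omega\|^2<\infty$. Let $L=(L_1,\dots,L_d):(\mathbb H^2_d\otimes\mathcal E)\otimes\mathbb C^d\to\mathbb H^2_d\otimes\mathcal E$ be the row isometry of left multiplications by the variables (tensored with $I_{\mathcal E}$), and let $U_{\mathrm t}$ be the unitary $\mathfrak z^\omega x\mapsto\mathfrak z^{\omega^{\mathrm t}}x$ reversing the letters of words ($x\in\mathcal E$). Let $\mathcal H,\mathcal J$ be separable complex Hilbert spaces, $\mathcal J\neq\{0\}$. A contractive left multiplier $b\in[\mathbb H^\infty_d\otimes\mathscr L(\mathcal H,\mathcal J)]_1$ is a formal power series $b=\sum_\omega\mathfrak z^\omega\hat b_\omega$, $\hat b_\omega\in\mathscr L(\mathcal H,\mathcal J)$,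 such that left multiplication by $b$ is a contraction $b(L):\mathbb H^2_d\otimes\mathcal H\to\mathbb H^2_d\otimes\mathcal J$; put $b(R):=U_{\mathrm t}\,b(L)\,U_{\mathrm t}$. The multiplier $b$ is inner if $b(L)$ is an isometry, and column-extreme (CE) if $a\in[\mathbb H^\infty_d\otimes\mathscr L(\mathcal H,\mathcal J)]_1$ and contractivity of the column $\left(\begin{smallmatrix}b\\a\end{smallmatrix}\right)$ as a left multiplier from $\mathbb H^2_d\otimes\mathcal H$ to $\mathbb H^2_d\otimes\mathcal J\otimes\mathbb C^2$ imply $a\equiv0$. Let $\mathscr H^{\mathrm t}(b)$ be the right free de Branges--Rovnyak space of $b$, that is, the range of $\sqrt{I-b(R)b(R)^*}$ with the Hilbert space norm that makes this operator a co-isometry onto its range. It is invariant under the backward left shifts $L_k^*$; let $X:=L^*|_{\mathscr H^{\mathrm t}(b)}:\mathscr H^{\mathrm t}(b)\to\mathscr H^{\mathrm t}(b)\otimes\mathbb C^d$, and let $\boldsymbol b:\mathcal H\to\mathscr H^{\mathrm t}(b)\otimes\mathbb C^d$ be the bounded operator $\boldsymbol b\,h:=L^*\,b(R)(1\otimes h)$.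 Let $X^{(n)}:=(X\otimes I_d\otimes\cdots\otimes I_d)\cdots(X\otimes I_d)X$ ($n$ factors), acting on $\mathscr H^{\mathrm t}(b)\otimes\mathbb C^d$ as $X^{(n)}\otimes I_d$, so that $\|X^{(n)}(x_k)_k\|^2=\sum_k\sum_{|\alpha|=n}\|X^\alpha x_k\|^2$, with norms in $\mathscr H^{\mathrm t}(b)$. A row $T=(T_1,\dots,T_d):\mathcal K\otimes\mathbb C^d\to\mathcal K$ is pure if $\mathrm{Ad}_{T,T^*}^{(n)}(I)\to0$ in the strong operator topology, where $\mathrm{Ad}_{T,T^*}(A)=\sum_kT_kAT_k^*$. **Theorem.** Let $b\in[\mathbb H^\infty_d\otimes\mathscr L(\mathcal H,\mathcal J)]_1$ be column-extreme. Then $b$ is inner if and only if $X^*$ obeys the weak purity condition $\|X^{(n)}\boldsymbol b\,h\|\to0$ as $n\to\infty$ for every $h\in\mathcal H$. In particular, $X^*$ is pure if and only if $b$ is inner. -/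

import Mathlib

noncomputable section

namespace FreeHardy

open ContinuousLinearMap

universe u v

/-! ### Hilbert-space direct sums `K ⊗ ℓ²(S)` -/

/-- The Hilbert space `K ⊗ ℓ²(S)` of square-summable families in `K` indexed by `S`.
In particular `K ⊗ ℂ^d` is `l2 ι K`, where `ι` has `d` elements. -/
abbrev l2 (S : Type u) (K : Type v) [NormedAddCommGroup K] : Type (max u v) :=
  lp (fun _ : S => K) 2

section l2

variable {S : Type*} {T : Type*} {K : Type*} [NormedAddCommGroup K]

theorem memlp_two_iff (f : S → K) : Memℓp f 2 ↔ Summable fun s => ‖f s‖ ^ 2 := by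
  rw [memℓp_gen_iff (by norm_num)]
  norm_num

theorem l2_hasSum (f : l2 S K) : HasSum (fun s => ‖f s‖ ^ 2) (‖f‖ ^ 2) := by
  have h := lp.hasSum_norm (p := 2) (by norm_num) f
  norm_num at h
  exact h

theorem l2_norm_sq (f : l2 S K) : ‖f‖ ^ 2 = ∑' s, ‖f s‖ ^ 2 := (l2_hasSum f).tsum_eq.symm

theorem extend_norm_sq {φ : S → T} (hφ : Function.Injective φ) (f : S → K) :
    (fun t => ‖Function.extend φ f 0 t‖ ^ 2) =
      Function.extend φ (fun s => ‖f s‖ ^ 2) 0 := by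
  classical
  funext t
  by_cases ht : ∃ s, φ s = t
  · obtain ⟨s, rfl⟩ := ht
    simp [hφ.extend_apply]
  · simp [Function.extend_apply' _ _ _ ht]

theorem extend_hasSum {φ : S → T} (hφ : Function.Injective φ) (f : l2 S K) :
    HasSum (fun t => ‖Function.extend φ (f : S → K) 0 t‖ ^ 2) (‖f‖ ^ 2) := by
  rw [extend_norm_sq hφ]
  exact (hasSum_extend_zero hφ).2 (l2_hasSum f)

variable [InnerProductSpace ℂ K]

/-- The isometry `K ⊗ ℓ²(S) → K ⊗ ℓ²(T)` which sends the basis vector `e_s` to `e_{φ s}`,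
for an injective map `φ`. -/
def push (φ : S → T) (hφ : Function.Injective φ) : l2 S K →ₗᵢ[ℂ] l2 T K where
  toFun f := ⟨Function.extend φ f 0, (memlp_two_iff _).2 (extend_hasSum hφ f).summable⟩
  map_add' f g := by
    ext t
    change Function.extend φ (⇑f + ⇑g) 0 t =
      Function.extend φ (⇑f) 0 t + Function.extend φ (⇑g) 0 t
    by_cases ht : ∃ s, φ s = t
    · obtain ⟨s, rfl⟩ := ht
      simp [Pi.add_apply, hφ.extend_apply]
    · simp [Function.extend_apply' _ _ _ ht]
  map_smul' c f := by
    ext t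
    by_cases ht : ∃ s, φ s = t
    · obtain ⟨s, rfl⟩ := ht
      simp [hφ.extend_apply]
    · simp [Function.extend_apply' _ _ _ ht]
  norm_map' f := by
    rw [← sq_eq_sq₀ (norm_nonneg _) (norm_nonneg _), l2_norm_sq]
    exact (extend_hasSum hφ f).tsum_eq

theorem push_apply (φ : S → T) (hφ : Function.Injective φ) (f : l2 S K) (s : S) :
    push φ hφ f (φ s) = f s :=
  hφ.extend_apply _ _ _

theorem push_apply_of_not (φ : S → T) (hφ : Function.Injective φ) (f : l2 S K) (t : T)
    (ht : ¬ ∃ s, φ s = t) : push φ hφ f t = 0 :=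
  Function.extend_apply' _ _ _ ht

theorem uncurry_hasSum (f : l2 S (l2 T K)) :
    HasSum (fun p : S × T => ‖f p.1 p.2‖ ^ 2) (‖f‖ ^ 2) := by
  have h1 : Summable fun p : S × T => ‖f p.1 p.2‖ ^ 2 := by
    rw [summable_prod_of_nonneg (fun _ => by positivity)]
    refine ⟨fun s => (l2_hasSum (f s)).summable, ?_⟩
    have := (l2_hasSum f).summable
    simpa only [l2_norm_sq] using this
  have h2 := h1.hasSum.prod_fiberwise fun s => l2_hasSum (f s)
  rw [(l2_hasSum f).unique h2]
  exact h1.hasSum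

/-- The canonical identification `(K ⊗ ℓ²(T)) ⊗ ℓ²(S) = K ⊗ ℓ²(S × T)`. -/
def uncurry : l2 S (l2 T K) →ₗᵢ[ℂ] l2 (S × T) K where
  toFun f := ⟨fun p => f p.1 p.2, (memlp_two_iff _).2 (uncurry_hasSum f).summable⟩
  map_add' f g := by ext p; rfl
  map_smul' c f := by ext p; rfl
  norm_map' f := by
    rw [← sq_eq_sq₀ (norm_nonneg _) (norm_nonneg _), l2_norm_sq]
    exact (uncurry_hasSum f).tsum_eq

/-- The ampliation `A ⊗ I : K ⊗ ℓ²(S) → K' ⊗ ℓ²(S)` of `A : K → K'`. -/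
def ampl (S : Type*) {K' : Type*} [NormedAddCommGroup K'] [InnerProductSpace ℂ K']
    (A : K →L[ℂ] K') : l2 S K →L[ℂ] l2 S K' :=
  lp.mapCLM 2 (fun _ => A) (norm_nonneg A) (fun _ => le_rfl)

theorem ampl_apply {K' : Type*} [NormedAddCommGroup K'] [InnerProductSpace ℂ K']
    (A : K →L[ℂ] K') (f : l2 S K) (s : S) : ampl S A f s = A (f s) := rfl

end l2

/-! ### Operator-range spaces -/

section OperatorRange

variable {K₁ K₂ : Type*} [NormedAddCommGroup K₁] [InnerProductSpace ℂ K₁] [CompleteSpace K₁]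
  [NormedAddCommGroup K₂] [InnerProductSpace ℂ K₂]

/-- The operator-range space `𝓜(A)`: as a vector space it is the range of `A`. Its norm (below) is
the one which makes `A` a co-isometry onto `𝓜(A)`. -/
def OperatorRange (A : K₁ →L[ℂ] K₂) : Type _ := LinearMap.range (A : K₁ →ₗ[ℂ] K₂)

namespace OperatorRange

variable (A : K₁ →L[ℂ] K₂)

instance : AddCommGroup (OperatorRange A) :=
  inferInstanceAs (AddCommGroup (LinearMap.range (A : K₁ →ₗ[ℂ] K₂)))

instance : Module ℂ (OperatorRange A) :=
  inferInstanceAs (Module ℂ (LinearMap.range (A : K₁ →ₗ[ℂ] K₂)))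

/-- The inclusion of `𝓜(A)` into the ambient space. -/
def incl : OperatorRange A →ₗ[ℂ] K₂ := (LinearMap.range (A : K₁ →ₗ[ℂ] K₂)).subtype

theorem incl_injective : Function.Injective (incl A) := Subtype.val_injective

/-- `A` is a bijection from `(ker A)ᗮ` onto its range. -/
def equiv : (LinearMap.ker (A : K₁ →ₗ[ℂ] K₂))ᗮ ≃ₗ[ℂ] OperatorRange A :=
  haveI : CompleteSpace (LinearMap.ker (A : K₁ →ₗ[ℂ] K₂)) :=
    (ContinuousLinearMap.isClosed_ker A).completeSpace_coe
  (A : K₁ →ₗ[ℂ] K₂).kerComplementEquivRange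
    (Submodule.isCompl_orthogonal _).symm

theorem incl_equiv (x : (LinearMap.ker (A : K₁ →ₗ[ℂ] K₂))ᗮ) : incl A (equiv A x) = A x := rfl

/-- The preimage under `A` of an element of `𝓜(A)` that is orthogonal to `ker A`. -/
def preimage : OperatorRange A →ₗ[ℂ] K₁ :=
  (LinearMap.ker (A : K₁ →ₗ[ℂ] K₂))ᗮ.subtype ∘ₗ (equiv A).symm.toLinearMap

theorem preimage_injective : Function.Injective (preimage A) :=
  Subtype.val_injective.comp (equiv A).symm.injective

theorem apply_preimage (f : OperatorRange A) : A (preimage A f) = incl A f := by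
  obtain ⟨x, rfl⟩ := (equiv A).surjective f
  simp [preimage, incl_equiv]

/-- The norm of `f ∈ 𝓜(A)` is the norm of its preimage in `(ker A)ᗮ`. -/
instance : NormedAddCommGroup (OperatorRange A) :=
  NormedAddCommGroup.induced _ _ (preimage A) (preimage_injective A)

instance : InnerProductSpace ℂ (OperatorRange A) := InnerProductSpace.induced (preimage A)

theorem norm_def (f : OperatorRange A) : ‖f‖ = ‖preimage A f‖ := rfl

/-- `preimage A` as a bounded operator. -/
def preimageCLM : OperatorRange A →L[ℂ] K₁ :=
  (preimage A).mkContinuous 1 fun f => by rw [one_mul, norm_def]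

/-- `A` restricts to a unitary from `(ker A)ᗮ` onto `𝓜(A)`. -/
def unitary : (LinearMap.ker (A : K₁ →ₗ[ℂ] K₂))ᗮ ≃ₗᵢ[ℂ] OperatorRange A where
  toLinearEquiv := equiv A
  norm_map' x := by simp [norm_def, preimage]

instance : CompleteSpace (OperatorRange A) :=
  (unitary A).toIsometryEquiv.completeSpace_iff.1 inferInstance

/-- `A`, viewed as an operator onto `𝓜(A)`. -/
def corestrict : K₁ →L[ℂ] OperatorRange A :=
  haveI : CompleteSpace (LinearMap.ker (A : K₁ →ₗ[ℂ] K₂)) :=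
    (ContinuousLinearMap.isClosed_ker A).completeSpace_coe
  (unitary A).toContinuousLinearEquiv.toContinuousLinearMap ∘L
    (LinearMap.ker (A : K₁ →ₗ[ℂ] K₂))ᗮ.orthogonalProjectionOnto

theorem incl_corestrict (x : K₁) : incl A (corestrict A x) = A x := by
  have : CompleteSpace (LinearMap.ker (A : K₁ →ₗ[ℂ] K₂)) :=
    (ContinuousLinearMap.isClosed_ker A).completeSpace_coe
  change A ((LinearMap.ker (A : K₁ →ₗ[ℂ] K₂))ᗮ.orthogonalProjectionOnto x : K₁) = A x
  have h := Submodule.sub_starProjection_mem_orthogonal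
    (K := (LinearMap.ker (A : K₁ →ₗ[ℂ] K₂))ᗮ) x
  rw [Submodule.orthogonal_orthogonal] at h
  have h' : A (x - (LinearMap.ker (A : K₁ →ₗ[ℂ] K₂))ᗮ.starProjection x) = 0 := h
  rw [map_sub, sub_eq_zero] at h'
  exact h'.symm

end OperatorRange

/-- `√(I - B B*)` for a contraction `B`. -/
def sqrtDefect [CompleteSpace K₂] (B : K₁ →L[ℂ] K₂) : K₂ →L[ℂ] K₂ :=
  CFC.sqrt (1 - B ∘L adjoint B)

theorem adjoint_sqrtDefect [CompleteSpace K₂] (B : K₁ →L[ℂ] K₂) :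
    adjoint (sqrtDefect B) = sqrtDefect B :=
  (IsSelfAdjoint.of_nonneg (CFC.sqrt_nonneg (1 - B ∘L adjoint B))).adjoint_eq

theorem norm_sqrtDefect_sq [CompleteSpace K₂] (B : K₁ →L[ℂ] K₂)
    (hB : ∀ f, ‖adjoint B f‖ ≤ ‖f‖) (f : K₂) :
    ‖sqrtDefect B f‖ ^ 2 = ‖f‖ ^ 2 - ‖adjoint B f‖ ^ 2 := by
  have hform : ∀ f : K₂, (inner ℂ ((1 - B ∘L adjoint B) f) f).re =
      ‖f‖ ^ 2 - ‖adjoint B f‖ ^ 2 := by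
    intro f
    have h1 := inner_self_eq_norm_sq (𝕜 := ℂ) f
    have h2 := inner_self_eq_norm_sq (𝕜 := ℂ) (adjoint B f)
    rw [adjoint_inner_right] at h2
    rw [sub_apply, inner_sub_left, Complex.sub_re]
    exact congrArg₂ _ h1 h2
  have hpos : 0 ≤ 1 - B ∘L adjoint B := by
    rw [nonneg_iff_isPositive]
    refine ⟨?_, fun f => ?_⟩
    · apply IsSelfAdjoint.isSymmetric
      rw [isSelfAdjoint_iff', map_sub, adjoint_comp, adjoint_adjoint]
      congr 1
      exact adjoint_id
    · have h3 : 0 ≤ ‖f‖ ^ 2 - ‖adjoint B f‖ ^ 2 := by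
        have := pow_le_pow_left₀ (norm_nonneg _) (hB f) 2
        linarith
      rw [← hform f] at h3
      exact h3
  have hsq : sqrtDefect B ∘L sqrtDefect B = 1 - B ∘L adjoint B := CFC.sqrt_mul_sqrt_self _ hpos
  rw [← hform f, ← hsq, ← inner_self_eq_norm_sq (𝕜 := ℂ), ← adjoint_inner_left,
    adjoint_sqrtDefect]
  rfl

/-- Douglas' factorization lemma. -/
theorem exists_factor {K₃ : Type*} [NormedAddCommGroup K₃] [InnerProductSpace ℂ K₃]
    [CompleteSpace K₃] [CompleteSpace K₂] (A : K₁ →L[ℂ] K₂) (D : K₃ →L[ℂ] K₂)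
    (h : ∀ y, ‖adjoint A y‖ ≤ ‖adjoint D y‖) : ∃ C : K₁ →L[ℂ] K₃, D ∘L C = A := by
  let M : Submodule ℂ K₃ := (LinearMap.range (adjoint D : K₂ →ₗ[ℂ] K₃)).topologicalClosure
  have : CompleteSpace M := (Submodule.isClosed_topologicalClosure _).completeSpace_coe
  let e : K₂ →ₗ[ℂ] M := LinearMap.codRestrict M (adjoint D : K₂ →ₗ[ℂ] K₃)
    fun y => Submodule.le_topologicalClosure _ ⟨y, rfl⟩
  have he : DenseRange e := by
    intro x
    rw [Topology.IsEmbedding.subtypeVal.closure_eq_preimage_closure_image, Set.mem_preimage]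
    have : (Subtype.val '' Set.range e : Set K₃) = LinearMap.range (adjoint D : K₂ →ₗ[ℂ] K₃) := by
      rw [← Set.range_comp]
      rfl
    rw [this]
    exact x.2
  let g : M →L[ℂ] K₁ := (adjoint A : K₂ →ₗ[ℂ] K₁).extendOfNorm e
  have hg : ∀ y, g (e y) = adjoint A y := fun y =>
    LinearMap.extendOfNorm_eq he ⟨1, fun y => by simpa [e] using h y⟩ y
  refine ⟨adjoint (g ∘L M.orthogonalProjectionOnto), ?_⟩
  apply (adjoint (𝕜 := ℂ)).injective
  rw [adjoint_comp, adjoint_adjoint]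
  ext y
  have : M.orthogonalProjectionOnto (adjoint D y) = e y :=
    Submodule.orthogonalProjectionOnto_mem_subspace_eq_self (e y)
  simp [this, hg]

end OperatorRange

/-! ### The full Fock space and operator-valued multipliers -/

/-- The free monoid on the alphabet `ι`; the word `i₁ ⋯ iₙ` is the list `[i₁, …, iₙ]`. -/
abbrev Word (ι : Type u) : Type u := List ι

/-- The vector-valued full Fock space `ℍ²_d ⊗ E`, `d = |ι|`: square-summable power series
`∑ 𝔷^ω f_ω` in the non-commuting variables `𝔷_i`, with coefficients `f_ω ∈ E`. -/
abbrev Fock (ι : Type u) (E : Type v) [NormedAddCommGroup E] : Type (max u v) := l2 (Word ι) E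

section Fock

variable (ι : Type*) (E : Type*) [NormedAddCommGroup E] [InnerProductSpace ℂ E]

theorem cons_injective : Function.Injective fun p : ι × Word ι => p.1 :: p.2 := by
  rintro ⟨i, α⟩ ⟨j, β⟩ h
  simpa using h

/-- The left free shift `L ⊗ I_E = (L₁ ⊗ I_E, …, L_d ⊗ I_E) : (ℍ²_d ⊗ E) ⊗ ℂ^d → ℍ²_d ⊗ E`,
a row isometry: `L_i` is left multiplication by `𝔷_i`, that is `L_i 𝔷^ω = 𝔷^{iω}`. -/
def leftShift : l2 ι (Fock ι E) →ₗᵢ[ℂ] Fock ι E :=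
  (push (fun p : ι × Word ι => p.1 :: p.2) (cons_injective ι)).comp uncurry

/-- The letter-reversal unitary `U_t ⊗ I_E`, `𝔷^ω ↦ 𝔷^{ωᵗ}`. -/
def reversal : Fock ι E →ₗᵢ[ℂ] Fock ι E := push List.reverse List.reverse_injective

/-- The embedding `h ↦ 1 ⊗ h` of `E` as the constants. -/
def vacuum : E →L[ℂ] Fock ι E :=
  haveI := Classical.decEq (Word ι)
  lp.singleContinuousLinearMap ℂ (fun _ : Word ι => E) 2 []

end Fock

section Multiplier

variable {ι : Type*} {H : Type*} {J : Type*}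
  [NormedAddCommGroup H] [InnerProductSpace ℂ H]
  [NormedAddCommGroup J] [InnerProductSpace ℂ J]

/-- The coefficients `∑_{αβ = ω} b_α f_β` of the product of the formal power series
`b = ∑ 𝔷^ω b_ω`, `b_ω ∈ 𝓛(H, J)`, and `f = ∑ 𝔷^ω f_ω`, `f_ω ∈ H`. -/
def seriesMul (b : Word ι → H →L[ℂ] J) (f : Word ι → H) (ω : Word ι) : J :=
  ∑ k ∈ Finset.range (ω.length + 1), b (ω.take k) (f (ω.drop k))

/-- Left multiplication by the formal power series `b` maps `ℍ²_d ⊗ H` contractively into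
`ℍ²_d ⊗ J`. -/
def IsContractiveMultiplier (b : Word ι → H →L[ℂ] J) : Prop :=
  ∀ f : Fock ι H, ∃ g : Fock ι J, (∀ ω, g ω = seriesMul b f ω) ∧ ‖g‖ ≤ ‖f‖

variable (ι H J) in
/-- The closed unit ball `[ℍ^∞_d ⊗ 𝓛(H, J)]₁` of contractive operator-valued left multipliers. -/
structure ContractiveMultiplier where
  /-- the Taylor coefficients -/
  coeff : Word ι → H →L[ℂ] J
  contractive : IsContractiveMultiplier coeff

namespace ContractiveMultiplier

theorem exists_op (b : ContractiveMultiplier ι H J) : ∃ B : Fock ι H →L[ℂ] Fock ι J,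
    (∀ f ω, B f ω = seriesMul b.coeff f ω) ∧ ‖B‖ ≤ 1 := by
  choose g hg hn using b.contractive
  let B₀ : Fock ι H →ₗ[ℂ] Fock ι J :=
    { toFun := g
      map_add' := fun x y => by
        ext ω
        simp [hg, seriesMul, Finset.sum_add_distrib]
      map_smul' := fun c x => by
        ext ω
        simp [hg, seriesMul, Finset.smul_sum] }
  exact ⟨B₀.mkContinuous 1 fun x => by simpa [B₀] using hn x, fun f ω => hg f ω,
    B₀.mkContinuous_norm_le zero_le_one _⟩

/-- The operator `b(L)` of left multiplication by `b`. -/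
def opL (b : ContractiveMultiplier ι H J) : Fock ι H →L[ℂ] Fock ι J := b.exists_op.choose

theorem opL_apply (b : ContractiveMultiplier ι H J) (f : Fock ι H) (ω : Word ι) :
    b.opL f ω = seriesMul b.coeff f ω := b.exists_op.choose_spec.1 f ω

theorem norm_opL_le (b : ContractiveMultiplier ι H J) : ‖b.opL‖ ≤ 1 := b.exists_op.choose_spec.2

/-- `b(R) = (U_t ⊗ I_J) b(L) (U_t ⊗ I_H)`, the operator of right multiplication by `bᵗ`. -/
def opR (b : ContractiveMultiplier ι H J) : Fock ι H →L[ℂ] Fock ι J :=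
  (reversal ι J).toContinuousLinearMap ∘L b.opL ∘L (reversal ι H).toContinuousLinearMap

/-- `b` is inner if the multiplication operator `b(L)` is an isometry. -/
def IsInner (b : ContractiveMultiplier ι H J) : Prop := Isometry b.opL

/-- The coefficients of the column `(b, a)ᵀ`, with values in `𝓛(H, J ⊗ ℂ²)`. -/
def column (b a : ContractiveMultiplier ι H J) (ω : Word ι) : H →L[ℂ] WithLp 2 (J × J) :=
  (WithLp.prodContinuousLinearEquiv 2 ℂ J J).symm.toContinuousLinearMap ∘L
    (b.coeff ω).prod (a.coeff ω)

/-- `b` is column-extreme if the column `(b, a)ᵀ` is contractive only for `a ≡ 0`. -/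
def IsColumnExtreme (b : ContractiveMultiplier ι H J) : Prop :=
  ∀ a : ContractiveMultiplier ι H J, IsContractiveMultiplier (column b a) → ∀ ω, a.coeff ω = 0

end ContractiveMultiplier
end Multiplier

/-! ### The right free de Branges--Rovnyak space -/

section DeBrangesRovnyak

variable {ι : Type*} {H : Type*} {J : Type*}
  [NormedAddCommGroup H] [InnerProductSpace ℂ H] [CompleteSpace H]
  [NormedAddCommGroup J] [InnerProductSpace ℂ J] [CompleteSpace J]

theorem adjoint_ampl {S K K' : Type*} [NormedAddCommGroup K] [InnerProductSpace ℂ K]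
    [CompleteSpace K] [NormedAddCommGroup K'] [InnerProductSpace ℂ K'] [CompleteSpace K']
    (A : K →L[ℂ] K') : adjoint (ampl S A) = ampl S (adjoint A) := by
  symm
  rw [eq_adjoint_iff]
  intro x y
  simp only [lp.inner_eq_tsum, ampl_apply, adjoint_inner_left]

theorem leftShift_cons {E : Type*} [NormedAddCommGroup E] [InnerProductSpace ℂ E]
    (y : l2 ι (Fock ι E)) (j : ι) (ω : Word ι) : leftShift ι E y (j :: ω) = y j ω :=
  push_apply (fun p : ι × Word ι => p.1 :: p.2) (cons_injective ι) (uncurry y) (j, ω)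

theorem leftShift_nil {E : Type*} [NormedAddCommGroup E] [InnerProductSpace ℂ E]
    (y : l2 ι (Fock ι E)) : leftShift ι E y [] = 0 :=
  push_apply_of_not (fun p : ι × Word ι => p.1 :: p.2) (cons_injective ι) (uncurry y) [] (by simp)

theorem reversal_apply {E : Type*} [NormedAddCommGroup E] [InnerProductSpace ℂ E]
    (f : Fock ι E) (ω : Word ι) : reversal ι E f ω = f ω.reverse := by
  conv_lhs => rw [← List.reverse_reverse ω]
  exact push_apply _ _ f ω.reverse

namespace ContractiveMultiplier

theorem norm_opR_apply_le (b : ContractiveMultiplier ι H J) (f : Fock ι H) :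
    ‖b.opR f‖ ≤ ‖f‖ := by
  change ‖reversal ι J (b.opL (reversal ι H f))‖ ≤ ‖f‖
  rw [LinearIsometry.norm_map]
  have := b.opL.le_of_opNorm_le b.norm_opL_le (reversal ι H f)
  rwa [LinearIsometry.norm_map, one_mul] at this

theorem opR_leftShift (b : ContractiveMultiplier ι H J) (y : l2 ι (Fock ι H)) :
    b.opR (leftShift ι H y) = leftShift ι J (ampl ι b.opR y) := by
  have key : ∀ (f : Fock ι H) (ω : Word ι), b.opR f ω =
      ∑ k ∈ Finset.range (ω.length + 1),
        b.coeff (ω.reverse.take k) (f (ω.reverse.drop k).reverse) := by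
    intro f ω
    change reversal ι J (b.opL (reversal ι H f)) ω = _
    simp only [reversal_apply, opL_apply, seriesMul, List.length_reverse]
  ext ω
  cases ω with
  | nil => simp [key, leftShift_nil]
  | cons j ω =>
    rw [leftShift_cons, ampl_apply, key, key, List.length_cons, Finset.sum_range_succ]
    have h0 : ((j :: ω).reverse.drop (ω.length + 1)).reverse = [] := by simp
    rw [h0, leftShift_nil, map_zero, add_zero]
    refine Finset.sum_congr rfl fun k hk => ?_
    have hk' : k ≤ ω.reverse.length := by
      have := Finset.mem_range.1 hk
      simp; omega
    rw [List.reverse_cons, List.take_append_of_le_length hk', List.drop_append_of_le_length hk',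
      List.reverse_append, List.reverse_singleton, List.singleton_append, leftShift_cons]

/-- The defect operator `√(I - b(R) b(R)*)`. -/
def defect (b : ContractiveMultiplier ι H J) : Fock ι J →L[ℂ] Fock ι J := sqrtDefect b.opR

/-- The right free de Branges--Rovnyak space `𝓗ᵗ(b) = 𝓜(√(I - b(R) b(R)*))`. -/
abbrev DBR (b : ContractiveMultiplier ι H J) := OperatorRange b.defect

theorem adjoint_defect (b : ContractiveMultiplier ι H J) : adjoint b.defect = b.defect :=
  adjoint_sqrtDefect b.opR

theorem norm_adjoint_opR_apply_le (b : ContractiveMultiplier ι H J) (f : Fock ι J) :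
    ‖adjoint b.opR f‖ ≤ ‖f‖ := by
  have h : ‖adjoint b.opR‖ ≤ 1 := by
    rw [LinearIsometryEquiv.norm_map]
    exact b.opR.opNorm_le_bound zero_le_one fun f => by simpa using b.norm_opR_apply_le f
  simpa using (adjoint b.opR).le_of_opNorm_le h f

theorem norm_defect_sq (b : ContractiveMultiplier ι H J) (f : Fock ι J) :
    ‖b.defect f‖ ^ 2 = ‖f‖ ^ 2 - ‖adjoint b.opR f‖ ^ 2 :=
  norm_sqrtDefect_sq b.opR b.norm_adjoint_opR_apply_le f

theorem adjoint_leftShift_adjoint_opR (b : ContractiveMultiplier ι H J) (y : l2 ι (Fock ι J)) :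
    adjoint (leftShift ι H).toContinuousLinearMap
      (adjoint b.opR (leftShift ι J y)) = ampl ι (adjoint b.opR) y := by
  apply ext_inner_left ℂ
  intro x
  rw [adjoint_inner_right, adjoint_inner_right, ← adjoint_ampl, adjoint_inner_right,
    ← (leftShift ι J).inner_map_map, ← opR_leftShift]
  rfl

theorem norm_ampl_defect_sq (b : ContractiveMultiplier ι H J) (y : l2 ι (Fock ι J)) :
    ‖ampl ι b.defect y‖ ^ 2 = ‖y‖ ^ 2 - ‖ampl ι (adjoint b.opR) y‖ ^ 2 := by
  have h := (l2_hasSum y).sub (l2_hasSum (ampl ι (adjoint b.opR) y))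
  refine (l2_hasSum (ampl ι b.defect y)).unique ?_
  have e : (fun j => ‖ampl ι b.defect y j‖ ^ 2) =
      fun j => ‖y j‖ ^ 2 - ‖ampl ι (adjoint b.opR) y j‖ ^ 2 :=
    funext fun j => b.norm_defect_sq (y j)
  rw [e]
  exact h

theorem norm_vacuum_add_leftShift_le (f : Fock ι H) :
    ‖adjoint (vacuum ι H) f‖ ^ 2 +
      ‖adjoint (leftShift ι H).toContinuousLinearMap f‖ ^ 2 ≤ ‖f‖ ^ 2 := by
  classical
  set a := adjoint (vacuum ι H) f with ha
  set z := adjoint (leftShift ι H).toContinuousLinearMap f with hz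
  have hvac : ∀ x : H, ‖vacuum ι H x‖ = ‖x‖ := fun x => by
    simp [vacuum, lp.norm_single]
  have horth : inner ℂ (vacuum ι H a) (leftShift ι H z) = 0 := by
    have : vacuum ι H a = lp.single 2 [] a := by
      simp only [vacuum, lp.singleContinuousLinearMap_apply]
      congr!
    rw [this, lp.inner_single_left, leftShift_nil, inner_zero_right]
  have h1 : ‖vacuum ι H a + leftShift ι H z‖ ^ 2 = ‖a‖ ^ 2 + ‖z‖ ^ 2 := by
    have := norm_add_sq_eq_norm_sq_add_norm_sq_of_inner_eq_zero _ _ horth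
    rw [hvac, LinearIsometry.norm_map] at this
    simpa only [sq] using this
  have h2 : (inner ℂ (vacuum ι H a + leftShift ι H z) f : ℂ).re = ‖a‖ ^ 2 + ‖z‖ ^ 2 := by
    have e1 : inner ℂ (vacuum ι H a) f = inner ℂ a a := (adjoint_inner_right _ _ _).symm
    have e2 : inner ℂ (leftShift ι H z) f = inner ℂ z z :=
      (adjoint_inner_right (leftShift ι H).toContinuousLinearMap z f).symm
    rw [inner_add_left, e1, e2, Complex.add_re]
    exact congrArg₂ _ (inner_self_eq_norm_sq (𝕜 := ℂ) a) (inner_self_eq_norm_sq (𝕜 := ℂ) z)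
  have h3 : (inner ℂ (vacuum ι H a + leftShift ι H z) f : ℂ).re ≤
      ‖vacuum ι H a + leftShift ι H z‖ * ‖f‖ := re_inner_le_norm (𝕜 := ℂ) _ _
  rw [h2] at h3
  nlinarith [norm_nonneg f, norm_nonneg (vacuum ι H a + leftShift ι H z),
    sq_nonneg (‖vacuum ι H a + leftShift ι H z‖ - ‖f‖)]

/-- An operator into `(ℍ²_d ⊗ J) ⊗ ℂ^d` that factors through `√(I - b(R) b(R)*) ⊗ I` takes its
values in `𝓗ᵗ(b) ⊗ ℂ^d`. -/
theorem exists_lift (b : ContractiveMultiplier ι H J) {K : Type*} [NormedAddCommGroup K]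
    [InnerProductSpace ℂ K] [CompleteSpace K] (A : K →L[ℂ] l2 ι (Fock ι J))
    (h : ∀ y, ‖adjoint A y‖ ^ 2 ≤ ‖y‖ ^ 2 - ‖ampl ι (adjoint b.opR) y‖ ^ 2) :
    ∃ C : K →L[ℂ] l2 ι b.DBR, ∀ x j, OperatorRange.incl b.defect (C x j) = A x j := by
  obtain ⟨C, hC⟩ := exists_factor A (ampl ι b.defect) fun y => by
    rw [adjoint_ampl, adjoint_defect]
    refine (sq_le_sq₀ (norm_nonneg _) (norm_nonneg _)).1 ?_
    rw [norm_ampl_defect_sq]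
    exact h y
  refine ⟨ampl ι (OperatorRange.corestrict b.defect) ∘L C, fun x j => ?_⟩
  rw [← hC]
  exact OperatorRange.incl_corestrict b.defect (C x j)

theorem exists_backwardShift (b : ContractiveMultiplier ι H J) :
    ∃ X : b.DBR →L[ℂ] l2 ι b.DBR, ∀ f j, OperatorRange.incl b.defect (X f j) =
      adjoint (leftShift ι J).toContinuousLinearMap (OperatorRange.incl b.defect f) j := by
  obtain ⟨C, hC⟩ := b.exists_lift
    (adjoint (leftShift ι J).toContinuousLinearMap ∘L b.defect) fun y => by
      rw [adjoint_comp, adjoint_adjoint, adjoint_defect]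
      change ‖b.defect (leftShift ι J y)‖ ^ 2 ≤ _
      rw [norm_defect_sq, LinearIsometry.norm_map]
      have h := norm_vacuum_add_leftShift_le (adjoint b.opR (leftShift ι J y))
      rw [adjoint_leftShift_adjoint_opR] at h
      nlinarith [sq_nonneg ‖adjoint (vacuum ι H) (adjoint b.opR (leftShift ι J y))‖]
  refine ⟨C ∘L OperatorRange.preimageCLM b.defect, fun f j => ?_⟩
  have h1 := hC (OperatorRange.preimage b.defect f) j
  have h2 := OperatorRange.apply_preimage b.defect f
  rw [← h2]
  exact h1

/-- `X = (L* ⊗ I_J)|_{𝓗ᵗ(b)} : 𝓗ᵗ(b) → 𝓗ᵗ(b) ⊗ ℂ^d`. -/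
def X (b : ContractiveMultiplier ι H J) : b.DBR →L[ℂ] l2 ι b.DBR := b.exists_backwardShift.choose

theorem incl_X (b : ContractiveMultiplier ι H J) (f : b.DBR) (j : ι) :
    OperatorRange.incl b.defect (b.X f j) =
      adjoint (leftShift ι J).toContinuousLinearMap (OperatorRange.incl b.defect f) j :=
  b.exists_backwardShift.choose_spec f j

theorem exists_bold (b : ContractiveMultiplier ι H J) :
    ∃ β : H →L[ℂ] l2 ι b.DBR, ∀ h j, OperatorRange.incl b.defect (β h j) =
      adjoint (leftShift ι J).toContinuousLinearMap (b.opR (vacuum ι H h)) j := by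
  refine b.exists_lift
    (adjoint (leftShift ι J).toContinuousLinearMap ∘L b.opR ∘L vacuum ι H) fun y => ?_
  rw [adjoint_comp, adjoint_comp, adjoint_adjoint]
  have h1 := norm_vacuum_add_leftShift_le (adjoint b.opR (leftShift ι J y))
  rw [adjoint_leftShift_adjoint_opR] at h1
  have h2 := b.norm_adjoint_opR_apply_le (leftShift ι J y)
  rw [LinearIsometry.norm_map] at h2
  have h3 := pow_le_pow_left₀ (norm_nonneg _) h2 2
  change ‖adjoint (vacuum ι H) (adjoint b.opR (leftShift ι J y))‖ ^ 2 ≤ _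
  linarith

/-- The operator `𝐛 : H → 𝓗ᵗ(b) ⊗ ℂ^d`, `𝐛 h = (L* ⊗ I_J) b(R) (1 ⊗ h)`. -/
def bold (b : ContractiveMultiplier ι H J) : H →L[ℂ] l2 ι b.DBR := b.exists_bold.choose

theorem incl_bold (b : ContractiveMultiplier ι H J) (h : H) (j : ι) :
    OperatorRange.incl b.defect (b.bold h j) =
      adjoint (leftShift ι J).toContinuousLinearMap (b.opR (vacuum ι H h)) j :=
  b.exists_bold.choose_spec h j

end ContractiveMultiplier
end DeBrangesRovnyak

/-! ### Purity -/

section Purity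

variable {ι : Type u} {K : Type v} [NormedAddCommGroup K] [InnerProductSpace ℂ K]

/-- `Ad_{T,T*}(A) = T₁ A T₁* + ⋯ + T_d A T_d* = T (A ⊗ I_d) T*` for a row
`T = (T₁, …, T_d) : K ⊗ ℂ^d → K`. -/
def adMap [CompleteSpace K] (T : l2 ι K →L[ℂ] K) (A : K →L[ℂ] K) : K →L[ℂ] K :=
  T ∘L ampl ι A ∘L adjoint T

/-- The row `T` is pure if `Ad_{T,T*}^{(n)}(I) → 0` in the strong operator topology. -/
def IsPure [CompleteSpace K] (T : l2 ι K →L[ℂ] K) : Prop :=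
  ∀ x : K, Filter.Tendsto (fun n : ℕ => ((adMap T)^[n] 1) x) Filter.atTop (nhds 0)

/-- The index set `S × ι × ⋯ × ι` (`n` factors `ι`), so that
`K ⊗ ℓ²(S) ⊗ (ℂ^d)^{⊗ n} = l2 (TensorIndex S ι n) K`. -/
def TensorIndex (S ι : Type u) : ℕ → Type u
  | 0 => S
  | n + 1 => TensorIndex S ι n × ι

/-- For a column `X : K → K ⊗ ℂ^d`, the operator
`X^{(n)} ⊗ I : K ⊗ ℓ²(S) → K ⊗ ℓ²(S) ⊗ (ℂ^d)^{⊗ n}`, where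
`X^{(n)} = (X ⊗ I ⊗ ⋯ ⊗ I) ⋯ (X ⊗ I) X`. -/
def iterColumn (S : Type u) (X : K →L[ℂ] l2 ι K) :
    (n : ℕ) → l2 S K →L[ℂ] l2 (TensorIndex S ι n) K
  | 0 => ContinuousLinearMap.id ℂ (l2 S K)
  | n + 1 => uncurry.toContinuousLinearMap ∘L ampl (TensorIndex S ι n) X ∘L iterColumn S X n

end Purity

end FreeHardy

end

/-!
The pair `(X, 𝐛)` and the coefficient maps `f ↦ f_∅`, `b_∅` form a contractive colligation on
`𝓗ᵗ(b) ⊕ H` whose transfer function is `b`. If some state reached from an impulse lost energy, then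
the defect operator of the colligation, followed by a contraction into `J`, would be the output of a
nonzero `a` for which the column `(b, a)` is still contractive; so column-extremality makes every
such trajectory conserve energy. Hence, if `X^(n) 𝐛 h → 0`, the energy `‖𝐛 h‖²` is the sum of the
energies of the outputs along the trajectory. The pure shift `L` produces the same outputs from
`L* b(R)(1 ⊗ h)`, so `‖𝐛 h‖ = ‖L* b(R)(1 ⊗ h)‖`, and adding the constant coefficient gives
`‖b(R)(1 ⊗ h)‖ = ‖h‖`. As `b(R)` commutes with the left shifts, `b(R)* b(R) = I` follows on the
whole Fock space, one letter at a time.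

Conversely, if `b` is inner, then `𝓗ᵗ(b)` sits isometrically in the Fock space, and `X` inherits the
purity of `L`.
-/

noncomputable section

namespace FreeHardy

open ContinuousLinearMap Filter Topology

universe u v

/-! ### Operators between Hilbert spaces -/

section Hilbert

variable {𝕜 K K₁ K₂ : Type*} [RCLike 𝕜]
  [NormedAddCommGroup K] [InnerProductSpace 𝕜 K]
  [NormedAddCommGroup K₁] [InnerProductSpace 𝕜 K₁]
  [NormedAddCommGroup K₂] [InnerProductSpace 𝕜 K₂]

theorem eq_zero_of_forall_contraction_apply_eq_zero {M J : Type*}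
    [NormedAddCommGroup M] [NormedSpace 𝕜 M] [NormedAddCommGroup J] [NormedSpace 𝕜 J]
    [Nontrivial J] {v : M} (hv : ∀ G : M →L[𝕜] J, ‖G‖ ≤ 1 → G v = 0) : v = 0 := by
  let _ : NormedSpace ℝ J := NormedSpace.restrictScalars ℝ 𝕜 J
  obtain ⟨u, hu⟩ := exists_norm_eq J zero_le_one
  obtain ⟨g, hg, hgv⟩ := exists_dual_vector'' 𝕜 v
  have hgu := hv (g.smulRight u) (by rwa [norm_smulRight_apply, hu, mul_one])
  rw [smulRight_apply, hgv] at hgu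
  simpa [norm_smul, hu] using congrArg norm hgu

/-- The row operator `(A₁, A₂) : K₁ ⊕ K₂ → K` on the Hilbert space direct sum. -/
def rowOp (A₁ : K₁ →L[𝕜] K) (A₂ : K₂ →L[𝕜] K) : WithLp 2 (K₁ × K₂) →L[𝕜] K :=
  A₁.coprod A₂ ∘L (WithLp.prodContinuousLinearEquiv 2 𝕜 K₁ K₂).toContinuousLinearMap

theorem rowOp_apply (A₁ : K₁ →L[𝕜] K) (A₂ : K₂ →L[𝕜] K) (x : WithLp 2 (K₁ × K₂)) :
    rowOp A₁ A₂ x = A₁ x.fst + A₂ x.snd := rfl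

/-- The column operator `(A₁, A₂)ᵀ : K → K₁ ⊕ K₂` into the Hilbert space direct sum. -/
def columnOp (A₁ : K →L[𝕜] K₁) (A₂ : K →L[𝕜] K₂) : K →L[𝕜] WithLp 2 (K₁ × K₂) :=
  (WithLp.prodContinuousLinearEquiv 2 𝕜 K₁ K₂).symm.toContinuousLinearMap ∘L A₁.prod A₂

theorem norm_columnOp_apply_sq (A₁ : K →L[𝕜] K₁) (A₂ : K →L[𝕜] K₂) (x : K) :
    ‖columnOp A₁ A₂ x‖ ^ 2 = ‖A₁ x‖ ^ 2 + ‖A₂ x‖ ^ 2 :=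
  WithLp.prod_norm_sq_eq_of_L2 _

variable [CompleteSpace K] [CompleteSpace K₁] [CompleteSpace K₂]

theorem norm_adjoint_rowOp_apply_sq (A₁ : K₁ →L[𝕜] K) (A₂ : K₂ →L[𝕜] K) (y : K) :
    ‖adjoint (rowOp A₁ A₂) y‖ ^ 2 = ‖adjoint A₁ y‖ ^ 2 + ‖adjoint A₂ y‖ ^ 2 := by
  have hadj : adjoint (rowOp A₁ A₂) y = WithLp.toLp 2 (adjoint A₁ y, adjoint A₂ y) := by
    refine ext_inner_left 𝕜 fun x => ?_
    simp only [adjoint_inner_right, WithLp.prod_inner_apply, rowOp_apply, inner_add_left,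
      WithLp.ofLp_fst, WithLp.ofLp_snd]
  rw [hadj, WithLp.prod_norm_sq_eq_of_L2, WithLp.toLp_fst, WithLp.toLp_snd]

theorem norm_adjoint_apply_le {B : K₁ →L[𝕜] K₂} (hB : ∀ x, ‖B x‖ ≤ ‖x‖) (y : K₂) :
    ‖adjoint B y‖ ≤ ‖y‖ := by
  have hnorm : ‖adjoint B‖ ≤ 1 := by
    rw [LinearIsometryEquiv.norm_map]
    exact B.opNorm_le_bound zero_le_one fun x => by simpa only [one_mul] using hB x
  simpa only [one_mul] using (adjoint B).le_of_opNorm_le hnorm y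

theorem adjoint_apply_apply_eq_self_iff {B : K₁ →L[𝕜] K₂} (hB : ∀ x, ‖B x‖ ≤ ‖x‖) (x : K₁) :
    adjoint B (B x) = x ↔ ‖B x‖ = ‖x‖ := by
  have hinner : RCLike.re (inner 𝕜 (adjoint B (B x)) x) = ‖B x‖ ^ 2 := by
    rw [adjoint_inner_left, inner_self_eq_norm_sq]
  constructor
  · intro h
    rw [h, inner_self_eq_norm_sq] at hinner
    exact ((sq_eq_sq₀ (norm_nonneg _) (norm_nonneg _)).1 hinner).symm
  · intro h
    have hle : ‖adjoint B (B x)‖ ≤ ‖x‖ := (norm_adjoint_apply_le hB _).trans_eq h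
    have hsub : ‖adjoint B (B x) - x‖ ^ 2 ≤ 0 := by
      rw [norm_sub_sq (𝕜 := 𝕜), hinner, h]
      nlinarith [pow_le_pow_left₀ (norm_nonneg _) hle 2]
    rwa [sq_nonpos_iff, norm_eq_zero, sub_eq_zero] at hsub

theorem denseRange_adjoint_of_injective {D : K₁ →L[𝕜] K₂} (hD : Function.Injective D) :
    DenseRange (adjoint D) := by
  have hclosure := D.orthogonal_ker
  rw [LinearMap.ker_eq_bot.2 hD, Submodule.bot_orthogonal_eq_top] at hclosure
  exact Submodule.dense_iff_topologicalClosure_eq_top.2 hclosure.symm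

theorem norm_le_of_apply_eq_of_norm_adjoint_le {A : K₁ →L[𝕜] K} {D : K₂ →L[𝕜] K}
    (hD : Function.Injective D) (hAD : ∀ y, ‖adjoint A y‖ ≤ ‖adjoint D y‖) {x : K₁} {z : K₂}
    (hz : D z = A x) : ‖z‖ ≤ ‖x‖ := by
  have hinner (w : K₂) : ‖(inner 𝕜 w z : 𝕜)‖ ≤ ‖w‖ * ‖x‖ := by
    induction w using (denseRange_adjoint_of_injective hD).induction_on with
    | hp => exact isClosed_le (by fun_prop) (by fun_prop)
    | ih y =>
      calc ‖(inner 𝕜 (adjoint D y) z : 𝕜)‖ = ‖(inner 𝕜 (adjoint A y) x : 𝕜)‖ := by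
            rw [adjoint_inner_left, adjoint_inner_left, hz]
        _ ≤ ‖adjoint A y‖ * ‖x‖ := norm_inner_le_norm _ _
        _ ≤ ‖adjoint D y‖ * ‖x‖ := by gcongr; exact hAD y
  rcases (norm_nonneg z).eq_or_lt with hz0 | hz0
  · exact hz0 ▸ norm_nonneg x
  · refine le_of_mul_le_mul_left ?_ hz0
    calc ‖z‖ * ‖z‖ = RCLike.re (inner 𝕜 z z) := (inner_self_eq_norm_mul_norm z).symm
      _ ≤ ‖(inner 𝕜 z z : 𝕜)‖ := RCLike.re_le_norm _
      _ ≤ ‖z‖ * ‖x‖ := hinner z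

end Hilbert

/-! ### Ampliations -/

section Ampliation

theorem l2_tendsto_zero_of_dominated {S K : Type*} [NormedAddCommGroup K] {F : ℕ → l2 S K}
    {f : l2 S K}
    (hF : ∀ s, Tendsto (fun n => F n s) atTop (𝓝 0)) (hle : ∀ n s, ‖F n s‖ ≤ ‖f s‖) :
    Tendsto F atTop (𝓝 0) := by
  have hsq : Tendsto (fun n => ∑' s, ‖F n s‖ ^ 2) atTop (𝓝 (∑' _ : S, (0 : ℝ))) := by
    refine tendsto_tsum_of_dominated_convergence (l2_hasSum f).summable
      (fun s => by simpa using (hF s).norm.pow 2) (.of_forall fun n s => ?_)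
    rw [Real.norm_of_nonneg (by positivity)]
    exact pow_le_pow_left₀ (norm_nonneg _) (hle n s) 2
  simp only [← l2_norm_sq, tsum_zero] at hsq
  rw [tendsto_zero_iff_norm_tendsto_zero]
  simpa using hsq.sqrt

variable {S : Type*} {K K' E : Type*}
  [NormedAddCommGroup K] [InnerProductSpace ℂ K]
  [NormedAddCommGroup K'] [InnerProductSpace ℂ K']
  [NormedAddCommGroup E] [InnerProductSpace ℂ E]

theorem norm_ampl_apply_le {A : K →L[ℂ] K'} (hA : ∀ x, ‖A x‖ ≤ ‖x‖) (f : l2 S K) :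
    ‖ampl S A f‖ ≤ ‖f‖ := by
  rw [← sq_le_sq₀ (norm_nonneg _) (norm_nonneg _)]
  refine hasSum_le (fun s => ?_) (l2_hasSum (ampl S A f)) (l2_hasSum f)
  exact pow_le_pow_left₀ (norm_nonneg _) (hA (f s)) 2

theorem norm_sq_ampl_add {A : K →L[ℂ] K'} {C : K →L[ℂ] E} {f : l2 S K}
    (hf : ∀ s, ‖A (f s)‖ ^ 2 + ‖C (f s)‖ ^ 2 = ‖f s‖ ^ 2) :
    ‖ampl S A f‖ ^ 2 + ‖ampl S C f‖ ^ 2 = ‖f‖ ^ 2 := by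
  have hsum := (l2_hasSum (ampl S A f)).add (l2_hasSum (ampl S C f))
  simp only [ampl_apply, hf] at hsum
  exact hsum.unique (l2_hasSum f)

end Ampliation

/-! ### Operator ranges -/

namespace OperatorRange

variable {K₁ K₂ : Type*} [NormedAddCommGroup K₁] [InnerProductSpace ℂ K₁] [CompleteSpace K₁]
  [NormedAddCommGroup K₂] [InnerProductSpace ℂ K₂]

/-- The inclusion of `𝓜(A)` into the ambient space, as a bounded operator. -/
def inclCLM (A : K₁ →L[ℂ] K₂) : OperatorRange A →L[ℂ] K₂ := A ∘L preimageCLM A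

theorem inclCLM_apply (A : K₁ →L[ℂ] K₂) (f : OperatorRange A) : inclCLM A f = incl A f :=
  apply_preimage A f

variable [CompleteSpace K₂]

theorem norm_adjoint_inclCLM_apply (A : K₁ →L[ℂ] K₂) (y : K₂) :
    ‖adjoint (inclCLM A) y‖ = ‖adjoint A y‖ := by
  have hadj : adjoint A y ∈ (LinearMap.ker (A : K₁ →ₗ[ℂ] K₂))ᗮ := fun x hx => by
    rw [adjoint_inner_right]
    exact (congrArg (inner ℂ · y) hx).trans (inner_zero_left y)
  have hpre : adjoint (preimageCLM A) (adjoint A y) = unitary A ⟨adjoint A y, hadj⟩ := by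
    refine ext_inner_left ℂ fun f => ?_
    obtain ⟨x, rfl⟩ := (unitary A).surjective f
    rw [adjoint_inner_right, LinearIsometryEquiv.inner_map_map]
    change inner ℂ (((equiv A).symm (equiv A x) : K₁)) (adjoint A y) = inner ℂ (x : K₁) _
    rw [LinearEquiv.symm_apply_apply]
    rfl
  rw [inclCLM, adjoint_comp, comp_apply, hpre, LinearIsometryEquiv.norm_map, Submodule.coe_norm]

theorem norm_inclCLM_sqrtDefect_apply {B : K₁ →L[ℂ] K₂} (hB : ∀ x, ‖B x‖ = ‖x‖)
    (f : OperatorRange (sqrtDefect B)) : ‖inclCLM (sqrtDefect B) f‖ = ‖f‖ := by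
  have hsq (y) : ‖sqrtDefect B y‖ ^ 2 = ‖y‖ ^ 2 - ‖adjoint B y‖ ^ 2 :=
    norm_sqrtDefect_sq B (norm_adjoint_apply_le fun x => (hB x).le) y
  have hker (x : K₁) : sqrtDefect B (B x) = 0 := by
    have hzero := hsq (B x)
    rw [(adjoint_apply_apply_eq_self_iff (fun x => (hB x).le) x).2 (hB x), hB, sub_self] at hzero
    exact norm_eq_zero.1 (sq_eq_zero_iff.1 hzero)
  obtain ⟨y, rfl⟩ := (unitary (sqrtDefect B)).surjective f
  have hadj : adjoint B (y : K₂) = 0 := by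
    refine ext_inner_left ℂ fun x => ?_
    rw [adjoint_inner_right, inner_zero_right]
    exact (Submodule.mem_orthogonal _ _).1 y.2 _ (hker x)
  rw [inclCLM_apply, LinearIsometryEquiv.norm_map, ← sq_eq_sq₀ (norm_nonneg _) (norm_nonneg _)]
  change ‖sqrtDefect B y‖ ^ 2 = ‖(y : K₂)‖ ^ 2
  rw [hsq, hadj, norm_zero, zero_pow two_ne_zero, sub_zero]

end OperatorRange

/-! ### Iterated columns and purity -/

section IterColumn

variable {ι S : Type u} {K : Type v} {K' E : Type*}
  [NormedAddCommGroup K] [InnerProductSpace ℂ K]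
  [NormedAddCommGroup K'] [InnerProductSpace ℂ K']
  [NormedAddCommGroup E] [InnerProductSpace ℂ E]

theorem norm_iterColumn_succ (X : K →L[ℂ] l2 ι K) (n : ℕ) (f : l2 S K) :
    ‖iterColumn S X (n + 1) f‖ = ‖ampl (TensorIndex S ι n) X (iterColumn S X n f)‖ :=
  LinearIsometry.norm_map uncurry _

theorem ampl_iterColumn {X : K →L[ℂ] l2 ι K} {Y : K' →L[ℂ] l2 ι K'} {V : K →L[ℂ] K'}
    (hV : ∀ x, ampl ι V (X x) = Y (V x)) (n : ℕ) (f : l2 S K) :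
    ampl (TensorIndex S ι n) V (iterColumn S X n f) = iterColumn S Y n (ampl S V f) := by
  induction n with
  | zero => rfl
  | succ n ih =>
    ext ⟨t, j⟩
    change ampl ι V (X (iterColumn S X n f t)) j = Y (iterColumn S Y n (ampl S V f) t) j
    rw [hV, ← ih, ampl_apply]

theorem hasSum_norm_sq_ampl_iterColumn {X : K →L[ℂ] l2 ι K} {C : K →L[ℂ] E} {f : l2 S K}
    (henergy : ∀ n t, ‖X (iterColumn S X n f t)‖ ^ 2 + ‖C (iterColumn S X n f t)‖ ^ 2 =
      ‖iterColumn S X n f t‖ ^ 2)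
    (hX : Tendsto (fun n => ‖iterColumn S X n f‖) atTop (𝓝 0)) :
    HasSum (fun n => ‖ampl (TensorIndex S ι n) C (iterColumn S X n f)‖ ^ 2) (‖f‖ ^ 2) := by
  rw [hasSum_iff_tendsto_nat_of_nonneg (fun n => by positivity)]
  have hstep (n : ℕ) : ‖ampl (TensorIndex S ι n) C (iterColumn S X n f)‖ ^ 2 =
      ‖iterColumn S X n f‖ ^ 2 - ‖iterColumn S X (n + 1) f‖ ^ 2 := by
    rw [norm_iterColumn_succ, ← norm_sq_ampl_add (henergy n), add_sub_cancel_left]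
  simp only [hstep, Finset.sum_range_sub']
  have hlim := (hX.pow 2).const_sub (‖f‖ ^ 2)
  rwa [zero_pow two_ne_zero, sub_zero] at hlim

end IterColumn

section Purity

variable {ι : Type u} {K : Type v} [NormedAddCommGroup K] [InnerProductSpace ℂ K] [CompleteSpace K]

theorem norm_adMap_iterate_apply_le {X : K →L[ℂ] l2 ι K} (hX : ∀ x, ‖X x‖ ≤ ‖x‖) (n : ℕ) (x : K) :
    ‖((adMap (adjoint X))^[n] 1) x‖ ≤ ‖x‖ := by
  induction n generalizing x with
  | zero => rfl
  | succ n ih =>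
    rw [Function.iterate_succ_apply', adMap, adjoint_adjoint]
    exact (norm_adjoint_apply_le hX _).trans ((norm_ampl_apply_le ih _).trans (hX x))

theorem inner_iterColumn_ampl_iterColumn {S : Type u} (X : K →L[ℂ] l2 ι K) (n : ℕ) (A : K →L[ℂ] K)
    (f g : l2 S K) :
    inner ℂ (iterColumn S X n f) (ampl (TensorIndex S ι n) A (iterColumn S X n g)) =
      inner ℂ f (ampl S ((adMap (adjoint X))^[n] A) g) := by
  induction n generalizing A with
  | zero => rfl
  | succ n ih =>
    rw [Function.iterate_succ_apply, ← ih]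
    calc
      _ = inner ℂ (ampl (TensorIndex S ι n) X (iterColumn S X n f))
            (ampl _ (ampl ι A) (ampl _ X (iterColumn S X n g))) :=
          (uncurry : l2 (TensorIndex S ι n) (l2 ι K) →ₗᵢ[ℂ] _).inner_map_map _ _
      _ = inner ℂ (iterColumn S X n f)
            (ampl _ (adjoint X) (ampl _ (ampl ι A) (ampl _ X (iterColumn S X n g)))) := by
          rw [← adjoint_ampl, adjoint_inner_right]
      _ = inner ℂ (iterColumn S X n f)
            (ampl _ (adMap (adjoint X) A) (iterColumn S X n g)) := by
          rw [adMap, adjoint_adjoint]; rfl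

theorem IsPure.tendsto_norm_iterColumn {S : Type u} {X : K →L[ℂ] l2 ι K} (hX : ∀ x, ‖X x‖ ≤ ‖x‖)
    (hpure : IsPure (adjoint X)) (f : l2 S K) :
    Tendsto (fun n => ‖iterColumn S X n f‖) atTop (𝓝 0) := by
  have hnorm (n : ℕ) : ‖iterColumn S X n f‖ ^ 2 =
      RCLike.re (inner ℂ f (ampl S ((adMap (adjoint X))^[n] 1) f)) := by
    rw [← inner_iterColumn_ampl_iterColumn, ← inner_self_eq_norm_sq (𝕜 := ℂ)]
    rfl
  have hampl : Tendsto (fun n => ampl S ((adMap (adjoint X))^[n] 1) f) atTop (𝓝 0) :=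
    l2_tendsto_zero_of_dominated (fun s => hpure (f s))
      fun n s => norm_adMap_iterate_apply_le hX n (f s)
  have hsq : Tendsto (fun n => ‖iterColumn S X n f‖ ^ 2) atTop (𝓝 0) := by
    simp only [hnorm]
    simpa using! (RCLike.continuous_re.tendsto _).comp
      ((tendsto_const_nhds (x := f)).inner (𝕜 := ℂ) hampl)
  simpa using hsq.sqrt

theorem IsPure.of_isometry {K' : Type*} [NormedAddCommGroup K'] [InnerProductSpace ℂ K']
    [CompleteSpace K'] {T : l2 ι K →L[ℂ] K} (hT : IsPure T) {X : K' →L[ℂ] l2 ι K'}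
    {V : K' →L[ℂ] K} (hV : ∀ x, ‖V x‖ = ‖x‖) (hX : ampl ι V ∘L X = adjoint T ∘L V) :
    IsPure (adjoint X) := by
  have hXadj : adjoint X ∘L ampl ι (adjoint V) = adjoint V ∘L T := by
    simpa only [adjoint_comp, adjoint_ampl, adjoint_adjoint] using congrArg adjoint hX
  have hiter (n : ℕ) : (adMap (adjoint X))^[n] 1 = adjoint V ∘L (adMap T)^[n] 1 ∘L V := by
    induction n with
    | zero => exact ((norm_map_iff_adjoint_comp_self V).1 hV).symm
    | succ n ih =>
      rw [Function.iterate_succ_apply', Function.iterate_succ_apply', ih]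
      calc adMap (adjoint X) (adjoint V ∘L (adMap T)^[n] 1 ∘L V)
          = (adjoint X ∘L ampl ι (adjoint V)) ∘L ampl ι ((adMap T)^[n] 1) ∘L ampl ι V ∘L X := by
            rw [adMap, adjoint_adjoint]; rfl
        _ = adjoint V ∘L adMap T ((adMap T)^[n] 1) ∘L V := by
            rw [hXadj, hX]; rfl
  intro x
  simp only [hiter]
  simpa only [map_zero, Function.comp_def] using! ((adjoint V).continuous.tendsto 0).comp (hT (V x))

end Purity

/-! ### Shifts on the Fock space -/

section Shift

variable {ι E : Type*} [NormedAddCommGroup E] [InnerProductSpace ℂ E]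

theorem vacuum_nil (x : E) : vacuum ι E x [] = x := by
  simp [vacuum]

theorem vacuum_of_ne_nil (x : E) {ω : Word ι} (hω : ω ≠ []) : vacuum ι E x ω = 0 := by
  simp [vacuum, hω]

theorem norm_vacuum (x : E) : ‖vacuum ι E x‖ = ‖x‖ := by
  simp [vacuum, lp.norm_single]

theorem reversal_reversal (f : Fock ι E) : reversal ι E (reversal ι E f) = f := by
  ext ω
  rw [reversal_apply, reversal_apply, List.reverse_reverse]

theorem reversal_vacuum (x : E) : reversal ι E (vacuum ι E x) = vacuum ι E x := by
  ext ω
  rw [reversal_apply]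
  by_cases hω : ω = []
  · rw [hω, List.reverse_nil]
  · rw [vacuum_of_ne_nil x hω, vacuum_of_ne_nil x (List.reverse_eq_nil_iff.not.2 hω)]

theorem leftShift_single [DecidableEq ι] (j : ι) (ω : Word ι) (x : E) :
    leftShift ι E (lp.single 2 j (lp.single 2 ω x)) = lp.single 2 (j :: ω) x := by
  ext α
  cases α with
  | nil => simp [leftShift_nil]
  | cons i α =>
    rw [leftShift_cons]
    rcases eq_or_ne i j with rfl | hij
    · rcases eq_or_ne α ω with rfl | hαω <;> simp_all
    · simp [hij]

variable [CompleteSpace E]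

theorem adjoint_vacuum_apply (f : Fock ι E) : adjoint (vacuum ι E) f = f [] := by
  classical
  refine ext_inner_left ℂ fun x => ?_
  have hsingle : vacuum ι E x = lp.single 2 [] x := by
    ext ω
    by_cases hω : ω = []
    · rw [hω, vacuum_nil, lp.single_apply_self]
    · rw [vacuum_of_ne_nil x hω, lp.single_apply_ne _ _ _ hω]
  rw [adjoint_inner_right, hsingle, lp.inner_single_left]

variable (ι E) in
/-- The backward shift `L* ⊗ I_E : ℍ²_d ⊗ E → (ℍ²_d ⊗ E) ⊗ ℂ^d`, which strips the first letter. -/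
abbrev backwardShift : Fock ι E →L[ℂ] l2 ι (Fock ι E) :=
  adjoint (leftShift ι E).toContinuousLinearMap

theorem backwardShift_apply (f : Fock ι E) (j : ι) (ω : Word ι) :
    backwardShift ι E f j ω = f (j :: ω) := by
  classical
  refine ext_inner_left ℂ fun x => ?_
  rw [← lp.inner_single_left (G := fun _ : Word ι => E) ω x,
    ← lp.inner_single_left (G := fun _ : ι => Fock ι E) j, adjoint_inner_right,
    LinearIsometry.coe_toContinuousLinearMap, leftShift_single, lp.inner_single_left]

theorem leftShift_backwardShift_add_vacuum (f : Fock ι E) :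
    leftShift ι E (backwardShift ι E f) + vacuum ι E (f []) = f := by
  ext ω
  rw [lp.coeFn_add, Pi.add_apply]
  cases ω with
  | nil => rw [vacuum_nil, leftShift_nil, zero_add]
  | cons j ω =>
    rw [vacuum_of_ne_nil _ (List.cons_ne_nil j ω), leftShift_cons, backwardShift_apply, add_zero]

theorem norm_sq_backwardShift_add (f : Fock ι E) :
    ‖backwardShift ι E f‖ ^ 2 + ‖f []‖ ^ 2 = ‖f‖ ^ 2 := by
  have horth : inner ℂ (leftShift ι E (backwardShift ι E f)) (vacuum ι E (f [])) = 0 := by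
    rw [← adjoint_inner_left, adjoint_vacuum_apply, leftShift_nil, inner_zero_left]
  have hpythagoras := norm_add_sq_eq_norm_sq_add_norm_sq_of_inner_eq_zero _ _ horth
  rw [leftShift_backwardShift_add_vacuum, norm_vacuum, LinearIsometry.norm_map] at hpythagoras
  simpa only [sq] using hpythagoras.symm

theorem norm_backwardShift_apply_le (f : Fock ι E) : ‖backwardShift ι E f‖ ≤ ‖f‖ :=
  norm_adjoint_apply_le (fun y => ((leftShift ι E).norm_map y).le) f

theorem backwardShift_vacuum (x : E) : backwardShift ι E (vacuum ι E x) = 0 := by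
  ext j ω
  rw [backwardShift_apply, vacuum_of_ne_nil x (List.cons_ne_nil j ω)]
  rfl

theorem adMap_leftShift_iterate_apply (n : ℕ) (f : Fock ι E) (ω : Word ι) :
    ((adMap (leftShift ι E).toContinuousLinearMap)^[n] 1) f ω =
      if n ≤ ω.length then f ω else 0 := by
  induction n generalizing f ω with
  | zero => simp
  | succ n ih =>
    rw [Function.iterate_succ_apply']
    change leftShift ι E (ampl ι _ (backwardShift ι E f)) ω = _
    cases ω with
    | nil => simp [leftShift_nil]
    | cons j ω => simp only [leftShift_cons, ampl_apply, ih, backwardShift_apply,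
        List.length_cons, Nat.add_le_add_iff_right]

theorem isPure_leftShift : IsPure (leftShift ι E).toContinuousLinearMap := by
  intro f
  refine l2_tendsto_zero_of_dominated (f := f) (fun ω => ?_) fun n ω => ?_
  · refine tendsto_const_nhds.congr' ?_
    filter_upwards [eventually_gt_atTop ω.length] with n hn
    rw [adMap_leftShift_iterate_apply, if_neg hn.not_ge]
  · rw [adMap_leftShift_iterate_apply]
    split_ifs <;> simp

end Shift

/-! ### Transfer functions of contractive colligations -/

section Words

variable {ι : Type*}

theorem exists_suffixClosed_superset (s : Finset (Word ι)) :
    ∃ F : Finset (Word ι), s ⊆ F ∧ ∀ j ω, j :: ω ∈ F → ω ∈ F := by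
  classical
  refine ⟨s.biUnion fun α => α.tails.toFinset, fun α hα => ?_, fun j ω hω => ?_⟩
  · simpa using ⟨α, hα, List.suffix_refl α⟩
  · simp only [Finset.mem_biUnion, List.mem_toFinset, List.mem_tails] at hω ⊢
    obtain ⟨α, hα, hsuffix⟩ := hω
    exact ⟨α, hα, (List.suffix_cons j ω).trans hsuffix⟩

theorem sum_le_sum_of_suffixClosed {p q y : Word ι → ℝ} (hp : ∀ ω, 0 ≤ p ω) (hp_nil : p [] = 0)
    (hstep : ∀ (ω : Word ι) (A : Finset ι), ∑ j ∈ A, p (j :: ω) + y ω ≤ p ω + q ω)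
    {F : Finset (Word ι)} (hF : ∀ j ω, j :: ω ∈ F → ω ∈ F) :
    ∑ ω ∈ F, y ω ≤ ∑ ω ∈ F, q ω := by
  classical
  let A : Finset ι := F.biUnion List.toFinset
  let children : Finset (Word ι) := (A ×ˢ F).image fun w => w.1 :: w.2
  have hcover : F ⊆ insert [] children := by
    rintro (_ | ⟨j, ω⟩) hω
    · exact Finset.mem_insert_self _ _
    · refine Finset.mem_insert_of_mem (Finset.mem_image.2 ⟨(j, ω), ?_, rfl⟩)
      exact Finset.mem_product.2 ⟨Finset.mem_biUnion.2 ⟨_, hω, by simp⟩, hF j ω hω⟩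
  have hpF : ∑ ω ∈ F, p ω ≤ ∑ ω ∈ F, ∑ j ∈ A, p (j :: ω) :=
    calc ∑ ω ∈ F, p ω ≤ ∑ ω ∈ insert [] children, p ω :=
          Finset.sum_le_sum_of_subset_of_nonneg hcover fun ω _ _ => hp ω
      _ = ∑ ω ∈ children, p ω := Finset.sum_insert_zero hp_nil
      _ = ∑ ω ∈ F, ∑ j ∈ A, p (j :: ω) := by
          rw [Finset.sum_image (cons_injective ι).injOn, Finset.sum_product_right]
  have hstepF := Finset.sum_le_sum fun ω (_ : ω ∈ F) => hstep ω A
  rw [Finset.sum_add_distrib, Finset.sum_add_distrib] at hstepF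
  linarith

theorem exists_l2_norm_le {S K : Type*} [NormedAddCommGroup K] {g : S → K} {c : ℝ} (hc : 0 ≤ c)
    (hg : ∀ s : Finset S, ∑ i ∈ s, ‖g i‖ ^ 2 ≤ c ^ 2) :
    ∃ G : l2 S K, (∀ i, G i = g i) ∧ ‖G‖ ≤ c := by
  refine ⟨⟨g, (memlp_two_iff g).2 (summable_of_sum_le (fun _ => by positivity) hg)⟩,
    fun _ => rfl, ?_⟩
  rw [← sq_le_sq₀ (norm_nonneg _) hc, l2_norm_sq]
  exact Real.tsum_le_of_sum_le (fun _ => by positivity) hg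

end Words

section Trajectory

variable {ι K H E E' : Type*}
  [NormedAddCommGroup K] [InnerProductSpace ℂ K]
  [NormedAddCommGroup H] [InnerProductSpace ℂ H]
  [NormedAddCommGroup E] [InnerProductSpace ℂ E]
  [NormedAddCommGroup E'] [InnerProductSpace ℂ E']

theorem seriesMul_cons (b : Word ι → H →L[ℂ] E) (f : Word ι → H) (j : ι) (ω : Word ι) :
    seriesMul b f (j :: ω) = seriesMul (fun α => b (j :: α)) f ω + b [] (f (j :: ω)) := by
  rw [seriesMul, List.length_cons, Finset.sum_range_succ']
  rfl

theorem seriesMul_comp (A : E →L[ℂ] E') (b : Word ι → H →L[ℂ] E) (f : Word ι → H) (ω : Word ι) :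
    seriesMul (fun α => A ∘L b α) f ω = A (seriesMul b f ω) := by
  simp only [seriesMul, map_sum, comp_apply]

/-- The inclusion `x ↦ (x, 0)` of the states. -/
def inState (K H : Type*) [NormedAddCommGroup K] [InnerProductSpace ℂ K]
    [NormedAddCommGroup H] [InnerProductSpace ℂ H] : K →L[ℂ] WithLp 2 (K × H) :=
  (WithLp.prodContinuousLinearEquiv 2 ℂ K H).symm.toContinuousLinearMap ∘L .inl ℂ K H

/-- The inclusion `h ↦ (0, h)` of the inputs. -/
def inInput (K H : Type*) [NormedAddCommGroup K] [InnerProductSpace ℂ K]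
    [NormedAddCommGroup H] [InnerProductSpace ℂ H] : H →L[ℂ] WithLp 2 (K × H) :=
  (WithLp.prodContinuousLinearEquiv 2 ℂ K H).symm.toContinuousLinearMap ∘L .inr ℂ K H

theorem norm_inState (x : K) : ‖inState K H x‖ = ‖x‖ :=
  WithLp.norm_toLp_fst 2 K H x

theorem norm_inInput (h : H) : ‖inInput K H h‖ = ‖h‖ :=
  WithLp.norm_toLp_snd 2 K H h

theorem rowOp_inState (A₁ : K →L[ℂ] E) (A₂ : H →L[ℂ] E) (x : K) :
    rowOp A₁ A₂ (inState K H x) = A₁ x := by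
  change A₁ x + A₂ 0 = A₁ x
  rw [map_zero, add_zero]

theorem rowOp_inInput (A₁ : K →L[ℂ] E) (A₂ : H →L[ℂ] E) (h : H) :
    rowOp A₁ A₂ (inInput K H h) = A₂ h := by
  change A₁ 0 + A₂ h = A₂ h
  rw [map_zero, zero_add]

/-- The state-input pairs generated by a unit impulse: the system `N : K ⊕ H → K ⊗ ℂ^d` is fed
the input `h` once, and then moves to the `j`-th component of its next state for each letter `j`,
the letters of a word being read from right to left. If `R : K ⊕ H → E` reads off the output, then
`∑ 𝔷^ω R ∘ trajectory N ω` is the transfer function of the colligation `(N, R)`. -/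
def trajectory (N : WithLp 2 (K × H) →L[ℂ] l2 ι K) : Word ι → H →L[ℂ] WithLp 2 (K × H)
  | [] => inInput K H
  | j :: ω => inState K H ∘L lp.evalCLM ℂ (fun _ : ι => K) 2 j ∘L N ∘L trajectory N ω

theorem trajectory_cons_apply (N : WithLp 2 (K × H) →L[ℂ] l2 ι K) (j : ι) (ω : Word ι) (h : H) :
    trajectory N (j :: ω) h = inState K H (N (trajectory N ω h) j) := rfl

theorem seriesMul_trajectory_nil (N : WithLp 2 (K × H) →L[ℂ] l2 ι K) (f : Word ι → H) :
    seriesMul (trajectory N) f [] = WithLp.toLp 2 (0, f []) := by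
  rw [seriesMul, List.length_nil, Finset.sum_range_one, List.take_nil, List.drop_nil]
  rfl

theorem seriesMul_trajectory_cons (N : WithLp 2 (K × H) →L[ℂ] l2 ι K) (f : Word ι → H) (j : ι)
    (ω : Word ι) : seriesMul (trajectory N) f (j :: ω) =
      WithLp.toLp 2 (N (seriesMul (trajectory N) f ω) j, f (j :: ω)) := by
  have hstep : seriesMul (fun α => trajectory N (j :: α)) f ω =
      inState K H (N (seriesMul (trajectory N) f ω) j) :=
    seriesMul_comp (inState K H ∘L lp.evalCLM ℂ (fun _ : ι => K) 2 j ∘L N) (trajectory N) f ω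
  rw [seriesMul_cons, hstep]
  change WithLp.toLp 2 (N (seriesMul (trajectory N) f ω) j + 0, 0 + f (j :: ω)) = _
  rw [add_zero, zero_add]

theorem sum_norm_sq_seriesMul_trajectory_cons_le {N : WithLp 2 (K × H) →L[ℂ] l2 ι K}
    (f : Word ι → H) (ω : Word ι) (A : Finset ι) :
    ∑ j ∈ A, ‖(seriesMul (trajectory N) f (j :: ω)).fst‖ ^ 2 ≤
      ‖N (seriesMul (trajectory N) f ω)‖ ^ 2 := by
  simp only [seriesMul_trajectory_cons]
  exact sum_le_hasSum A (fun _ _ => by positivity) (l2_hasSum _)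

theorem isContractiveMultiplier_comp_trajectory {N : WithLp 2 (K × H) →L[ℂ] l2 ι K}
    {R : WithLp 2 (K × H) →L[ℂ] E} (hNR : ∀ v, ‖N v‖ ^ 2 + ‖R v‖ ^ 2 ≤ ‖v‖ ^ 2) :
    IsContractiveMultiplier fun ω => R ∘L trajectory N ω := by
  intro f
  simp only [seriesMul_comp]
  set v := seriesMul (trajectory N) f with hv
  have hinput (ω : Word ι) : (v ω).snd = f ω := by
    cases ω with
    | nil => rw [hv, seriesMul_trajectory_nil, WithLp.toLp_snd]
    | cons j ω => rw [hv, seriesMul_trajectory_cons, WithLp.toLp_snd]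
  have hnorm (ω : Word ι) : ‖v ω‖ ^ 2 = ‖(v ω).fst‖ ^ 2 + ‖f ω‖ ^ 2 := by
    rw [WithLp.prod_norm_sq_eq_of_L2, hinput]
  refine exists_l2_norm_le (norm_nonneg f) fun s => ?_
  obtain ⟨F, hsF, hF⟩ := exists_suffixClosed_superset s
  calc ∑ ω ∈ s, ‖R (v ω)‖ ^ 2 ≤ ∑ ω ∈ F, ‖R (v ω)‖ ^ 2 :=
        Finset.sum_le_sum_of_subset_of_nonneg hsF fun _ _ _ => by positivity
    _ ≤ ∑ ω ∈ F, ‖f ω‖ ^ 2 := by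
        refine sum_le_sum_of_suffixClosed (p := fun ω => ‖(v ω).fst‖ ^ 2)
          (fun _ => by positivity) ?_ (fun ω A => ?_) hF
        · rw [hv, seriesMul_trajectory_nil]
          simp
        · have hstate := sum_norm_sq_seriesMul_trajectory_cons_le (N := N) f ω A
          rw [← hnorm]
          exact (add_le_add_left hstate _).trans (hNR (v ω))
    _ ≤ ‖f‖ ^ 2 := sum_le_hasSum F (fun _ _ => by positivity) (l2_hasSum f)

theorem exists_trajectory_rowOp_eq (X : K →L[ℂ] l2 ι K) (β : H →L[ℂ] l2 ι K) (h : H) (n : ℕ)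
    (t : TensorIndex ι ι n) :
    ∃ ω, trajectory (rowOp X β) ω h = inState K H (iterColumn ι X n (β h) t) := by
  induction n with
  | zero =>
    refine ⟨[t], ?_⟩
    change inState K H (rowOp X β (inInput K H h) t) = _
    rw [rowOp_inInput]
    rfl
  | succ n ih =>
    obtain ⟨ω, hω⟩ := ih t.1
    refine ⟨t.2 :: ω, ?_⟩
    rw [trajectory_cons_apply, hω, rowOp_inState]
    rfl

end Trajectory

section ColumnExtreme

variable {ι K H J : Type*}
  [NormedAddCommGroup K] [InnerProductSpace ℂ K]
  [NormedAddCommGroup H] [InnerProductSpace ℂ H]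
  [NormedAddCommGroup J] [InnerProductSpace ℂ J]
  {N : WithLp 2 (K × H) →L[ℂ] l2 ι K} {R : WithLp 2 (K × H) →L[ℂ] J}
  {b : ContractiveMultiplier ι H J}

theorem ContractiveMultiplier.IsColumnExtreme.comp_trajectory_eq_zero (hb : b.IsColumnExtreme)
    (hR : ∀ ω, b.coeff ω = R ∘L trajectory N ω) {R' : WithLp 2 (K × H) →L[ℂ] J}
    (hNRR' : ∀ v, ‖N v‖ ^ 2 + ‖R v‖ ^ 2 + ‖R' v‖ ^ 2 ≤ ‖v‖ ^ 2) (ω : Word ι) :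
    R' ∘L trajectory N ω = 0 := by
  let a : ContractiveMultiplier ι H J :=
    ⟨_, isContractiveMultiplier_comp_trajectory (N := N) (R := R') fun v => by
      nlinarith [hNRR' v, sq_nonneg ‖R v‖]⟩
  have hcolumn : ContractiveMultiplier.column b a =
      fun ω => columnOp R R' ∘L trajectory N ω := by
    funext ω
    rw [ContractiveMultiplier.column, hR ω]
    rfl
  refine hb a ?_ ω
  rw [hcolumn]
  refine isContractiveMultiplier_comp_trajectory fun v => ?_
  rw [norm_columnOp_apply_sq, ← add_assoc]
  exact hNRR' v

theorem ContractiveMultiplier.IsColumnExtreme.norm_sq_trajectory [CompleteSpace K]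
    [CompleteSpace H] [CompleteSpace J] [Nontrivial J] (hb : b.IsColumnExtreme)
    (hNR : ∀ v, ‖N v‖ ^ 2 + ‖R v‖ ^ 2 ≤ ‖v‖ ^ 2)
    (hR : ∀ ω, b.coeff ω = R ∘L trajectory N ω) (ω : Word ι) (h : H) :
    ‖N (trajectory N ω h)‖ ^ 2 + ‖R (trajectory N ω h)‖ ^ 2 = ‖trajectory N ω h‖ ^ 2 := by
  let Δ := sqrtDefect (adjoint (columnOp N R))
  have hΔ (v) : ‖Δ v‖ ^ 2 = ‖v‖ ^ 2 - (‖N v‖ ^ 2 + ‖R v‖ ^ 2) := by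
    rw [norm_sqrtDefect_sq, adjoint_adjoint, norm_columnOp_apply_sq]
    intro v
    rw [adjoint_adjoint, ← sq_le_sq₀ (norm_nonneg _) (norm_nonneg _),
      norm_columnOp_apply_sq]
    exact hNR v
  have hzero : Δ (trajectory N ω h) = 0 := by
    refine eq_zero_of_forall_contraction_apply_eq_zero (𝕜 := ℂ) (J := J) fun G hG => ?_
    refine DFunLike.congr_fun (hb.comp_trajectory_eq_zero hR (R' := G ∘L Δ) (fun v => ?_) ω) h
    have hGΔ : ‖G (Δ v)‖ ^ 2 ≤ ‖Δ v‖ ^ 2 :=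
      pow_le_pow_left₀ (norm_nonneg _) (by simpa using G.le_of_opNorm_le hG (Δ v)) 2
    rw [hΔ] at hGΔ
    change _ + ‖G (Δ v)‖ ^ 2 ≤ _
    linarith
  have henergy := hΔ (trajectory N ω h)
  rw [hzero, norm_zero] at henergy
  linarith

end ColumnExtreme

/-! ### The de Branges–Rovnyak colligation -/

section Colligation

variable {ι H J : Type*}
  [NormedAddCommGroup H] [InnerProductSpace ℂ H]
  [NormedAddCommGroup J] [InnerProductSpace ℂ J]

theorem seriesMul_vacuum (b : Word ι → H →L[ℂ] J) (h : H) (ω : Word ι) :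
    seriesMul b (vacuum ι H h) ω = b ω h := by
  rw [seriesMul, Finset.sum_range_succ, Finset.sum_eq_zero, zero_add, List.take_length,
    List.drop_length, vacuum_nil]
  intro k hk
  rw [vacuum_of_ne_nil, map_zero]
  simpa using hk

namespace ContractiveMultiplier

variable (b : ContractiveMultiplier ι H J)

theorem opR_vacuum_apply (h : H) (ω : Word ι) :
    b.opR (vacuum ι H h) ω = b.coeff ω.reverse h := by
  change reversal ι J (b.opL (reversal ι H (vacuum ι H h))) ω = _
  rw [reversal_apply, reversal_vacuum, opL_apply, seriesMul_vacuum]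

variable [CompleteSpace H] [CompleteSpace J]

theorem ampl_inclCLM_X (f : b.DBR) :
    ampl ι (OperatorRange.inclCLM b.defect) (b.X f) =
      backwardShift ι J (OperatorRange.inclCLM b.defect f) := by
  ext1
  funext j
  rw [ampl_apply, OperatorRange.inclCLM_apply, OperatorRange.inclCLM_apply, incl_X]

theorem ampl_inclCLM_bold (h : H) :
    ampl ι (OperatorRange.inclCLM b.defect) (b.bold h) =
      backwardShift ι J (b.opR (vacuum ι H h)) := by
  ext1
  funext j
  rw [ampl_apply, OperatorRange.inclCLM_apply, incl_bold]

/-- The output operator `f ↦ f_∅` of `𝓗ᵗ(b)`. -/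
def constCoeff : b.DBR →L[ℂ] J :=
  adjoint (vacuum ι J) ∘L OperatorRange.inclCLM b.defect

theorem constCoeff_apply (f : b.DBR) :
    b.constCoeff f = OperatorRange.inclCLM b.defect f [] :=
  adjoint_vacuum_apply _

/-- The next-state operator `(X, 𝐛) : 𝓗ᵗ(b) ⊕ H → 𝓗ᵗ(b) ⊗ ℂ^d` of the de Branges–Rovnyak
colligation, whose transfer function is `b`. -/
def nextState : WithLp 2 (b.DBR × H) →L[ℂ] l2 ι b.DBR := rowOp b.X b.bold

/-- The output operator `(ev_∅, b_∅) : 𝓗ᵗ(b) ⊕ H → J` of the de Branges–Rovnyak colligation. -/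
def output : WithLp 2 (b.DBR × H) →L[ℂ] J := rowOp b.constCoeff (b.coeff [])

/-- The operator `(f, h) ↦ f + b(R)(1 ⊗ h)`: the power series of all future outputs of the
de Branges–Rovnyak colligation, started in the state `f` with the single input `h`. -/
def observability : WithLp 2 (b.DBR × H) →L[ℂ] Fock ι J :=
  rowOp (OperatorRange.inclCLM b.defect) (b.opR ∘L vacuum ι H)

theorem ampl_inclCLM_nextState (v : WithLp 2 (b.DBR × H)) :
    ampl ι (OperatorRange.inclCLM b.defect) (b.nextState v) =
      backwardShift ι J (b.observability v) := by
  rw [nextState, rowOp_apply, map_add, ampl_inclCLM_X, ampl_inclCLM_bold, ← map_add]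
  rfl

theorem output_apply (v : WithLp 2 (b.DBR × H)) : b.output v = b.observability v [] := by
  have hcoeff : b.coeff [] v.snd = b.opR (vacuum ι H v.snd) [] := by
    rw [opR_vacuum_apply, List.reverse_nil]
  rw [output, rowOp_apply, constCoeff_apply, hcoeff]
  rfl

theorem observability_trajectory_apply (ω α : Word ι) (h : H) :
    b.observability (trajectory b.nextState ω h) α = b.coeff (α.reverse ++ ω) h := by
  induction ω generalizing α with
  | nil =>
    rw [trajectory, observability, rowOp_inInput, comp_apply, opR_vacuum_apply, List.append_nil]
  | cons j ω ih =>
    have hstate : b.observability (trajectory b.nextState (j :: ω) h) =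
        backwardShift ι J (b.observability (trajectory b.nextState ω h)) j := by
      rw [← ampl_inclCLM_nextState, ampl_apply, trajectory_cons_apply]
      exact rowOp_inState _ _ _
    rw [hstate, backwardShift_apply, ih, List.reverse_cons, List.append_assoc,
      List.singleton_append]

theorem coeff_eq_output_comp_trajectory (ω : Word ι) :
    b.coeff ω = b.output ∘L trajectory b.nextState ω := by
  ext h
  rw [comp_apply, output_apply, observability_trajectory_apply, List.reverse_nil, List.nil_append]

/-- The operator `(f, x) ↦ ∑ 𝔷_j f_j + x` on `(𝓗ᵗ(b) ⊗ ℂ^d) ⊕ J`: it puts a power series together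
from its constant coefficient and its backward shifts. -/
def assemble : WithLp 2 (l2 ι b.DBR × J) →L[ℂ] Fock ι J :=
  rowOp ((leftShift ι J).toContinuousLinearMap ∘L ampl ι (OperatorRange.inclCLM b.defect))
    (vacuum ι J)

theorem assemble_injective : Function.Injective b.assemble := by
  rw [injective_iff_map_eq_zero]
  intro w hw
  have hcoeff (ω : Word ι) : leftShift ι J (ampl ι (OperatorRange.inclCLM b.defect) w.fst) ω +
      vacuum ι J w.snd ω = 0 := congrArg (fun f : Fock ι J => f ω) hw
  have hsnd : w.snd = 0 := by simpa only [leftShift_nil, vacuum_nil, zero_add] using hcoeff []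
  have hfst : w.fst = 0 := by
    ext1
    funext j
    refine OperatorRange.incl_injective b.defect ?_
    rw [← OperatorRange.inclCLM_apply]
    ext ω
    simpa only [leftShift_cons, ampl_apply, hsnd, map_zero, lp.coeFn_zero, Pi.zero_apply, add_zero]
      using hcoeff (j :: ω)
  exact WithLp.ofLp_injective 2 (Prod.ext hfst hsnd)

theorem assemble_columnOp_apply (v : WithLp 2 (b.DBR × H)) :
    b.assemble (columnOp b.nextState b.output v) = b.observability v := by
  change leftShift ι J (ampl ι (OperatorRange.inclCLM b.defect) (b.nextState v)) +
    vacuum ι J (b.output v) = _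
  rw [ampl_inclCLM_nextState, output_apply, leftShift_backwardShift_add_vacuum]

theorem backwardShift_adjoint_opR (f : Fock ι J) :
    backwardShift ι H (adjoint b.opR f) = ampl ι (adjoint b.opR) (backwardShift ι J f) := by
  have hintertwine : b.opR ∘L (leftShift ι H).toContinuousLinearMap =
      (leftShift ι J).toContinuousLinearMap ∘L ampl ι b.opR :=
    ContinuousLinearMap.ext b.opR_leftShift
  have hadj := congrArg adjoint hintertwine
  rw [adjoint_comp, adjoint_comp, adjoint_ampl] at hadj
  exact DFunLike.congr_fun hadj f

theorem norm_adjoint_observability_apply_sq (y : Fock ι J) :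
    ‖adjoint b.observability y‖ ^ 2 =
      ‖y‖ ^ 2 - ‖ampl ι (adjoint b.opR) (backwardShift ι J y)‖ ^ 2 := by
  rw [observability, norm_adjoint_rowOp_apply_sq, OperatorRange.norm_adjoint_inclCLM_apply,
    adjoint_defect, norm_defect_sq, adjoint_comp, comp_apply, adjoint_vacuum_apply,
    ← norm_sq_backwardShift_add (adjoint b.opR y), backwardShift_adjoint_opR]
  ring

theorem norm_adjoint_assemble_apply_sq (y : Fock ι J) :
    ‖adjoint b.assemble y‖ ^ 2 =
      ‖y‖ ^ 2 - ‖ampl ι (adjoint b.opR) (backwardShift ι J y)‖ ^ 2 := by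
  have hdefect (f : l2 ι (Fock ι J)) :
      ‖ampl ι (adjoint (OperatorRange.inclCLM b.defect)) f‖ ^ 2 = ‖ampl ι b.defect f‖ ^ 2 := by
    simp only [l2_norm_sq, ampl_apply, OperatorRange.norm_adjoint_inclCLM_apply, adjoint_defect]
  rw [assemble, norm_adjoint_rowOp_apply_sq, adjoint_comp, comp_apply, adjoint_ampl, hdefect,
    norm_ampl_defect_sq, adjoint_vacuum_apply, ← norm_sq_backwardShift_add y]
  ring

/-- Douglas' lemma, applied to `assemble_columnOp_apply`: by the two preceding formulas,
`observability` and `assemble` have the same `A A*`. -/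
theorem norm_sq_nextState_add_norm_sq_output_le (v : WithLp 2 (b.DBR × H)) :
    ‖b.nextState v‖ ^ 2 + ‖b.output v‖ ^ 2 ≤ ‖v‖ ^ 2 := by
  rw [← norm_columnOp_apply_sq]
  refine pow_le_pow_left₀ (norm_nonneg _) (norm_le_of_apply_eq_of_norm_adjoint_le
    b.assemble_injective (fun y => ?_) (b.assemble_columnOp_apply v)) 2
  rw [← sq_le_sq₀ (norm_nonneg _) (norm_nonneg _), norm_adjoint_observability_apply_sq,
    norm_adjoint_assemble_apply_sq]

theorem norm_X_apply_le (f : b.DBR) : ‖b.X f‖ ≤ ‖f‖ := by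
  have hbalance := b.norm_sq_nextState_add_norm_sq_output_le (inState b.DBR H f)
  rw [norm_inState, nextState, rowOp_inState] at hbalance
  rw [← sq_le_sq₀ (norm_nonneg _) (norm_nonneg _)]
  linarith [sq_nonneg ‖b.output (inState b.DBR H f)‖]

end ContractiveMultiplier
end Colligation

/-! ### Inner multipliers -/

namespace ContractiveMultiplier

section Inner

variable {ι H J : Type*}
  [NormedAddCommGroup H] [InnerProductSpace ℂ H]
  [NormedAddCommGroup J] [InnerProductSpace ℂ J] {b : ContractiveMultiplier ι H J}

theorem isInner_iff_norm_opR : b.IsInner ↔ ∀ f, ‖b.opR f‖ = ‖f‖ := by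
  have hreversal (f : Fock ι H) : ‖b.opR f‖ = ‖b.opL (reversal ι H f)‖ :=
    LinearIsometry.norm_map (reversal ι J) _
  rw [IsInner, AddMonoidHomClass.isometry_iff_norm]
  refine ⟨fun h f => by rw [hreversal, h, LinearIsometry.norm_map], fun h f => ?_⟩
  simpa only [hreversal, reversal_reversal, LinearIsometry.norm_map] using h (reversal ι H f)

variable [CompleteSpace H] [CompleteSpace J]

theorem adjoint_opR_opR_vacuum {h : H} (hb : ‖b.opR (vacuum ι H h)‖ = ‖h‖) :
    adjoint b.opR (b.opR (vacuum ι H h)) = vacuum ι H h :=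
  (adjoint_apply_apply_eq_self_iff b.norm_opR_apply_le _).2 (hb.trans (norm_vacuum h).symm)

theorem adjoint_opR_opR_apply_nil (hb : ∀ h, ‖b.opR (vacuum ι H h)‖ = ‖h‖) (f : Fock ι H) :
    adjoint b.opR (b.opR f) [] = f [] := by
  refine ext_inner_left ℂ fun h => ?_
  rw [← adjoint_vacuum_apply, ← adjoint_vacuum_apply f, adjoint_inner_right, adjoint_inner_right,
    adjoint_inner_right, ← adjoint_inner_left, adjoint_opR_opR_vacuum (hb h)]

theorem backwardShift_adjoint_opR_opR (hb : ∀ h, ‖b.opR (vacuum ι H h)‖ = ‖h‖) (f : Fock ι H) :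
    backwardShift ι H (adjoint b.opR (b.opR f)) =
      ampl ι (adjoint b.opR) (ampl ι b.opR (backwardShift ι H f)) := by
  conv_lhs => rw [← leftShift_backwardShift_add_vacuum f]
  rw [map_add, map_add, map_add, adjoint_opR_opR_vacuum (hb _), backwardShift_vacuum,
    add_zero, opR_leftShift]
  exact b.adjoint_leftShift_adjoint_opR _

theorem isInner_of_norm_opR_vacuum (hb : ∀ h, ‖b.opR (vacuum ι H h)‖ = ‖h‖) : b.IsInner := by
  refine isInner_iff_norm_opR.2 fun f =>
    (adjoint_apply_apply_eq_self_iff b.norm_opR_apply_le f).1 ?_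
  ext ω
  induction ω generalizing f with
  | nil => exact adjoint_opR_opR_apply_nil hb f
  | cons j ω ih =>
    rw [← backwardShift_apply, backwardShift_adjoint_opR_opR hb, ampl_apply, ampl_apply, ih,
      backwardShift_apply]

end Inner

variable {ι : Type u} {H J : Type*}
  [NormedAddCommGroup H] [InnerProductSpace ℂ H] [CompleteSpace H]
  [NormedAddCommGroup J] [InnerProductSpace ℂ J] [CompleteSpace J]
  {b : ContractiveMultiplier ι H J}

theorem IsInner.isPure_adjoint_X (hb : b.IsInner) : IsPure (adjoint b.X) :=
  isPure_leftShift.of_isometry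
    (OperatorRange.norm_inclCLM_sqrtDefect_apply (isInner_iff_norm_opR.1 hb))
    (ContinuousLinearMap.ext b.ampl_inclCLM_X)

/-! ### Column-extreme multipliers -/

theorem hasSum_norm_sq_constCoeff_iterColumn_bold (b : ContractiveMultiplier ι H J) (h : H) :
    HasSum (fun n => ‖ampl (TensorIndex ι ι n) b.constCoeff (iterColumn ι b.X n (b.bold h))‖ ^ 2)
      (‖backwardShift ι J (b.opR (vacuum ι H h))‖ ^ 2) := by
  have hpure : IsPure (adjoint (backwardShift ι J)) := by
    rw [backwardShift, adjoint_adjoint]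
    exact isPure_leftShift
  have houtput (n : ℕ) :
      ampl (TensorIndex ι ι n) b.constCoeff (iterColumn ι b.X n (b.bold h)) =
        ampl (TensorIndex ι ι n) (adjoint (vacuum ι J)) (iterColumn ι (backwardShift ι J) n
          (backwardShift ι J (b.opR (vacuum ι H h)))) := by
    rw [← ampl_inclCLM_bold, ← ampl_iterColumn b.ampl_inclCLM_X]
    rfl
  simp only [houtput]
  refine hasSum_norm_sq_ampl_iterColumn (fun n t => ?_)
    (hpure.tendsto_norm_iterColumn norm_backwardShift_apply_le _)
  rw [adjoint_vacuum_apply]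
  exact norm_sq_backwardShift_add _

variable [Nontrivial J]

theorem IsColumnExtreme.norm_sq_nextState_trajectory (hb : b.IsColumnExtreme) (ω : Word ι)
    (h : H) :
    ‖b.nextState (trajectory b.nextState ω h)‖ ^ 2 + ‖b.output (trajectory b.nextState ω h)‖ ^ 2 =
      ‖trajectory b.nextState ω h‖ ^ 2 :=
  hb.norm_sq_trajectory b.norm_sq_nextState_add_norm_sq_output_le
    b.coeff_eq_output_comp_trajectory ω h

theorem IsColumnExtreme.norm_sq_bold_add (hb : b.IsColumnExtreme) (h : H) :
    ‖b.bold h‖ ^ 2 + ‖b.coeff [] h‖ ^ 2 = ‖h‖ ^ 2 := by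
  simpa only [trajectory, nextState, output, rowOp_inInput, norm_inInput]
    using hb.norm_sq_nextState_trajectory [] h

theorem IsColumnExtreme.norm_sq_X_iterColumn_add (hb : b.IsColumnExtreme) (h : H) (n : ℕ)
    (t : TensorIndex ι ι n) :
    ‖b.X (iterColumn ι b.X n (b.bold h) t)‖ ^ 2 +
      ‖b.constCoeff (iterColumn ι b.X n (b.bold h) t)‖ ^ 2 =
      ‖iterColumn ι b.X n (b.bold h) t‖ ^ 2 := by
  obtain ⟨ω, hω⟩ := exists_trajectory_rowOp_eq b.X b.bold h n t
  have henergy := hb.norm_sq_nextState_trajectory ω h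
  simpa only [nextState, output, hω, rowOp_inState, norm_inState] using henergy

theorem IsColumnExtreme.norm_opR_vacuum (hb : b.IsColumnExtreme) {h : H}
    (hweak : Tendsto (fun n => ‖iterColumn ι b.X n (b.bold h)‖) atTop (𝓝 0)) :
    ‖b.opR (vacuum ι H h)‖ = ‖h‖ := by
  have hbold : ‖backwardShift ι J (b.opR (vacuum ι H h))‖ ^ 2 = ‖b.bold h‖ ^ 2 :=
    (b.hasSum_norm_sq_constCoeff_iterColumn_bold h).unique
      (hasSum_norm_sq_ampl_iterColumn (hb.norm_sq_X_iterColumn_add h) hweak)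
  rw [← sq_eq_sq₀ (norm_nonneg _) (norm_nonneg _), ← norm_sq_backwardShift_add, hbold,
    opR_vacuum_apply, List.reverse_nil, hb.norm_sq_bold_add]

end ContractiveMultiplier

end FreeHardy

end

theorem mainTheorem6_general {ι : Type*} {H J : Type*}
    [NormedAddCommGroup H] [InnerProductSpace ℂ H] [CompleteSpace H]
    [NormedAddCommGroup J] [InnerProductSpace ℂ J] [CompleteSpace J] [Nontrivial J]
    (b : FreeHardy.ContractiveMultiplier ι H J) (hb : b.IsColumnExtreme) :
    (b.IsInner ↔ ∀ h : H, Filter.Tendsto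
      (fun n : ℕ => ‖FreeHardy.iterColumn ι b.X n (b.bold h)‖) Filter.atTop (nhds 0)) ∧
    (FreeHardy.IsPure (ContinuousLinearMap.adjoint b.X) ↔ b.IsInner) := by
  have weak_of_pure (hpure : FreeHardy.IsPure (ContinuousLinearMap.adjoint b.X)) (h : H) :=
    hpure.tendsto_norm_iterColumn b.norm_X_apply_le (b.bold h)
  have inner_of_weak (hweak : ∀ h : H, Filter.Tendsto
      (fun n : ℕ => ‖FreeHardy.iterColumn ι b.X n (b.bold h)‖) Filter.atTop (nhds 0)) :
      b.IsInner :=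
    FreeHardy.ContractiveMultiplier.isInner_of_norm_opR_vacuum fun h => hb.norm_opR_vacuum (hweak h)
  exact ⟨⟨fun hinner => weak_of_pure hinner.isPure_adjoint_X, inner_of_weak⟩,
    fun hpure => inner_of_weak (weak_of_pure hpure), fun hinner => hinner.isPure_adjoint_X⟩

theorem mainTheorem6 {ι : Type*} [Countable ι] {H J : Type*}
    [NormedAddCommGroup H] [InnerProductSpace ℂ H] [CompleteSpace H]
    [TopologicalSpace.SeparableSpace H]
    [NormedAddCommGroup J] [InnerProductSpace ℂ J] [CompleteSpace J]
    [TopologicalSpace.SeparableSpace J] [Nontrivial J]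
    (b : FreeHardy.ContractiveMultiplier ι H J) (hb : b.IsColumnExtreme) :
    (b.IsInner ↔ ∀ h : H, Filter.Tendsto
      (fun n : ℕ => ‖FreeHardy.iterColumn ι b.X n (b.bold h)‖) Filter.atTop (nhds 0)) ∧
    (FreeHardy.IsPure (ContinuousLinearMap.adjoint b.X) ↔ b.IsInner) :=
  mainTheorem6_general b hb
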